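/- **Model.** Let $M,N,m\ge 1$ and $\sigma>0$. A sequence of $M+N-1$ complex symbols $a(-N+1),\dots,a(M-1)$ is received through $m$ FIR channels of length $N$ with coefficients $\boldsymbol h(0),\dots,\boldsymbol h(N-1)\in\mathbb C^m$: $$\boldsymbol y(k)=\sum_{i=0}^{N-1}\boldsymbol h(i)\,a(k-i)+\boldsymbol v(k),\qquad k=0,\dots,M-1 .$$ Put $Y=[\boldsymbol y(M-1)^T\cdots\boldsymbol y(0)^T]^T$, $A=[a(M-1)\cdots a(-N+1)]^T$, $h=[\boldsymbol h(0)^T\cdots\boldsymbol h(N-1)^T]^T$. Then $Y=\mathcal T(h)A+V$, where $\mathcal T(h)$ is the $Mm\times(M+N-1)$ block Toeplitz matrix with first block row $[\boldsymbol h(0)\cdots\boldsymbol h(N-1)\;0\cdots0]$, and $V$ is circular complex Gaussian with mean $0$ and covariance $\sigma^2I$. Let $\mathcal A=\bar A\otimes I_m$, where $\bar A$ is the $M\times N$ matrix with $(r,i)$ entry $a(M-1-r-i)$, $0\le r<M$, $0\le i<N$, so that $\mathcal T(h)A=\mathcal A h$. Both $A$ and $h$ are deterministic and unknown, $\theta=[A^T\;h^T]^T$,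 and $f(Y|\theta)$ is the density of $Y$. The complex Fisher information matrix (FIM) is $$J_{\theta\theta}=\mathrm E_{Y|\theta}\left[\left(\frac{\partial\ln f(Y|\theta)}{\partial\theta^*}\right)\left(\frac{\partial\ln f(Y|\theta)}{\partial\theta^*}\right)^{H}\right],\qquad \frac{\partial}{\partial\theta^*}=\frac12\left(\frac{\partial}{\partial\operatorname{Re}\theta}+j\frac{\partial}{\partial\operatorname{Im}\theta}\right).$$ The channel is *locally blindly identifiable up to a scale factor* at $\theta=[A^T\;h^T]^T$ if there is a neighbourhood $U$ of $\theta$ such that every $\theta'=[A'^T\;h'^T]^T\in U$ with $f(\cdot|\theta')=f(\cdot|\theta)$ satisfies $A'=\alpha A$, $h'=h/\alpha$ for some $\alpha\in\mathbb C\setminus\{0\}$. **Theorem.** For all $A\in\mathbb C^{M+N-1}$ and $h\in\mathbb C^{Nm}$: 1. $J_{\theta\theta}=\sigma^{-2}\,[\mathcal T(h)\;\mathcal A]^H[\mathcal T(h)\;\mathcal A]$. 2. The channel is locally blindly identifiable up to a scale factor at $\theta$ if and only if $J_{\theta\theta}$ has exactly one singularity, i.e. $\dim_{\mathbb C}\ker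 J_{\theta\theta}=1$. 3. In that case $\ker J_{\theta\theta}$ is spanned by $[-A^T\;\;h^T]^T$. -/

import Mathlib

open scoped Matrix Topology

noncomputable section

/-- Index set of the parameter vector `θ = [Aᵀ hᵀ]ᵀ`: first the `M + N - 1` input symbols
(entry `s` of `A` is the symbol `a(M - 1 - s)`), then the `N m` channel coefficients
(entry `(i, c)` of `h` is the coefficient of delay `i` of subchannel `c`). -/
abbrev ParamIdx (M N m : ℕ) : Type := Fin (M + N - 1) ⊕ (Fin N × Fin m)

/-- Index set of the observation vector: entry `(r, c)` is the sample `y_c(M - 1 - r)`. -/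
abbrev ObsIdx (M m : ℕ) : Type := Fin M × Fin m

/-- The input symbols in the parameter vector `θ = [Aᵀ hᵀ]ᵀ`. -/
def symbolPart {M N m : ℕ} (θ : ParamIdx M N m → ℂ) : Fin (M + N - 1) → ℂ :=
  fun s => θ (Sum.inl s)

/-- The channel coefficients in the parameter vector `θ = [Aᵀ hᵀ]ᵀ`. -/
def channelPart {M N m : ℕ} (θ : ParamIdx M N m → ℂ) : Fin N × Fin m → ℂ :=
  fun p => θ (Sum.inr p)

/-- The block Toeplitz matrix `T(h)` with `M` block rows and first block row
`[h(0) ⋯ h(N-1) 0 ⋯ 0]`. -/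
def channelMatrix (M : ℕ) {N m : ℕ} (h : Fin N × Fin m → ℂ) :
    Matrix (ObsIdx M m) (Fin (M + N - 1)) ℂ :=
  Matrix.of fun p s => ∑ i : Fin N, if (s : ℕ) = (p.1 : ℕ) + (i : ℕ) then h (i, p.2) else 0

/-- The `M × N` matrix of symbols whose row `r` is `a(k), a(k-1), …, a(k-N+1)` for the time
`k = M - 1 - r`. -/
def symbolHankel {M N : ℕ} (A : Fin (M + N - 1) → ℂ) : Matrix (Fin M) (Fin N) ℂ :=
  Matrix.of fun r i => A ⟨(r : ℕ) + (i : ℕ), by omega⟩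

/-- The matrix `𝒜 = A' ⊗ I_m`, for which `T(h) A = 𝒜 h`. -/
def symbolMatrix {M N : ℕ} (m : ℕ) (A : Fin (M + N - 1) → ℂ) :
    Matrix (ObsIdx M m) (Fin N × Fin m) ℂ :=
  Matrix.kroneckerMap (· * ·) (symbolHankel A) (1 : Matrix (Fin m) (Fin m) ℂ)

/-- Commutativity of convolution. -/
theorem channelMatrix_mulVec_eq {M N m : ℕ} (A : Fin (M + N - 1) → ℂ)
    (h : Fin N × Fin m → ℂ) :
    channelMatrix M h *ᵥ A = symbolMatrix m A *ᵥ h := by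
  funext p
  simp only [channelMatrix, symbolMatrix, symbolHankel, Matrix.mulVec, dotProduct,
    Matrix.of_apply, Matrix.kroneckerMap_apply, Fintype.sum_prod_type, Matrix.one_apply,
    Finset.sum_mul]
  rw [Finset.sum_comm]
  refine Finset.sum_congr rfl fun i _ => ?_
  rw [Finset.sum_eq_single (⟨(p.1 : ℕ) + (i : ℕ), by omega⟩ : Fin (M + N - 1))]
  · simp [mul_comm]
  · intro s _ hs
    have : ¬ ((s : ℕ) = (p.1 : ℕ) + (i : ℕ)) := fun e => hs (Fin.ext e)
    simp [this]
  · simp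

/-- The density at `y` of the circular complex Gaussian law with mean `μ` and (positive definite)
covariance matrix `C`; the determinant and the quadratic form are real numbers. -/
def complexGaussianDensity {ι : Type*} [Fintype ι] [DecidableEq ι]
    (μ : ι → ℂ) (C : Matrix ι ι ℂ) (y : ι → ℂ) : ℝ :=
  (Real.pi ^ Fintype.card ι * C.det.re)⁻¹ *
    Real.exp (-(star (y - μ) ⬝ᵥ (C⁻¹ *ᵥ (y - μ))).re)

/-- The density `f(y | θ)` of the observation `Y = T(h) A + V`, where `V` is circular white
complex Gaussian noise with covariance `σ² I`. -/
def likelihood {M N m : ℕ} (σ : ℝ) (θ : ParamIdx M N m → ℂ) (y : ObsIdx M m → ℂ) : ℝ :=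
  complexGaussianDensity (channelMatrix M (channelPart θ) *ᵥ symbolPart θ)
    (((σ : ℂ) ^ 2) • (1 : Matrix (ObsIdx M m) (ObsIdx M m) ℂ)) y

/-- The derivative `∂g/∂θ_k^* = (∂g/∂α_k + j ∂g/∂β_k) / 2`, where `θ = α + j β`. -/
def conjDeriv {κ : Type*} [DecidableEq κ] (g : (κ → ℂ) → ℝ) (θ : κ → ℂ) (k : κ) : ℂ :=
  (1 / 2 : ℂ) * (Complex.ofReal (lineDeriv ℝ g θ (Pi.single k 1))
    + Complex.I * Complex.ofReal (lineDeriv ℝ g θ (Pi.single k Complex.I)))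

/-- The complex Fisher information matrix
`J_θθ = E[(∂ ln f(Y|θ) / ∂θ^*) (∂ ln f(Y|θ) / ∂θ^*)ᴴ]`, with `Y` of density `f(· | θ)`. -/
def complexFIM {M N m : ℕ} (σ : ℝ) (θ : ParamIdx M N m → ℂ) :
    Matrix (ParamIdx M N m) (ParamIdx M N m) ℂ :=
  Matrix.of fun k l => ∫ y : ObsIdx M m → ℂ,
    likelihood σ θ y • (conjDeriv (fun θ' => Real.log (likelihood σ θ' y)) θ k
      * star (conjDeriv (fun θ' => Real.log (likelihood σ θ' y)) θ l))

/-- `θ'` is obtained from `θ` by the blind scale ambiguity `(h, A) ↦ (h / α, α A)`, `α ≠ 0`. -/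
def ScaleEquivalent {M N m : ℕ} (θ θ' : ParamIdx M N m → ℂ) : Prop :=
  ∃ α : ℂ, α ≠ 0 ∧ symbolPart θ' = α • symbolPart θ ∧ channelPart θ' = α⁻¹ • channelPart θ

/-- Local blind identifiability up to a scale factor at `θ`: every `θ'` in some neighbourhood of
`θ` that gives the same law of the observation is obtained from `θ` by the scale ambiguity. -/
def LocallyBlindlyIdentifiable {M N m : ℕ} (σ : ℝ) (θ : ParamIdx M N m → ℂ) : Prop :=
  ∃ U ∈ 𝓝 θ, ∀ θ' ∈ U,
    (∀ y : ObsIdx M m → ℂ, likelihood σ θ y = likelihood σ θ' y) → ScaleEquivalent θ θ'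

/-- The block matrix `[T(h) 𝒜]`. -/
def jacobianMatrix {M N m : ℕ} (A : Fin (M + N - 1) → ℂ) (h : Fin N × Fin m → ℂ) :
    Matrix (ObsIdx M m) (ParamIdx M N m) ℂ :=
  Matrix.fromCols (channelMatrix M h) (symbolMatrix m A)

end

/-! ### The noiseless observation as a bilinear map -/

/-! The mean `T(h) A` is bilinear in `(A, h)` with Jacobian `J = [T(h) 𝒜]`. The score is `σ⁻² Jᴴ V`,
so the FIM is `σ⁻² Jᴴ J` and has the kernel of `J`. Two parameters give the same law exactly when
their means agree (`likelihood_eq_iff`). Everything then concerns the fibres of a bilinear map.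

If the kernel is a line, it is the tangent `(-A, h)` of the scale orbit. By bilinearity the
difference of two means is exactly `J` at the midpoint applied to the difference of the parameters
(`jacobianMatrix_midpoint_mulVec`). Rescaling a nearby parameter so that one nonzero coordinate
agrees with that of `θ` leaves a difference in the kernel of an injective matrix.

The converse is the hard direction, since a singular Jacobian does not by itself produce a curve in
the fibre. Read `A` as the functional `φ : X^s ↦ A_s` and each subchannel as a polynomial `h_c` of
degree less than `N`; the mean has entries `φ(X^r h_c)`. As in Sylvester's theory of binary forms,
the annihilator of `φ` has two generators `q₁`, `q₂` without common zero, infinity included, of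
formal degrees `a + 1 ≤ b + 1` with `a + b + 2 = M + N` (`exists_isApolarPair`), and they determine
`φ` up to a factor (`IsApolarPair.exists_eq_mul`). Identifiability excludes a noninjective symbol
matrix, and `A = 0` and `h = 0` are treated directly. Otherwise there are two cases.

If the shifts `X^j h_c` span all polynomials of degree less than `a`, the symbol part of any kernel
vector is annihilated by both generators, hence is proportional to `A`, and injectivity fixes the
channel part (`IsApolarPair.ker_le_span`).

If they do not, some `r` pairs to zero under `φ` with those shifts but not with all polynomials of
degree less than `a`. Deforming `q₂` to `q₂ + t r` deforms `A` (`IsApolarPair.exists_symbols`), and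
the channel can follow with the mean unchanged (`IsApolarPair.exists_channels`). The deformed
symbols are not proportional to `A`, which contradicts identifiability. -/

theorem channelMatrix_mulVec_apply {M N m : ℕ} (A : Fin (M + N - 1) → ℂ)
    (h : Fin N × Fin m → ℂ) (p : ObsIdx M m) :
    (channelMatrix M h *ᵥ A) p
      = ∑ i : Fin N, h (i, p.2) * A ⟨(p.1 : ℕ) + (i : ℕ), by omega⟩ := by
  rw [channelMatrix_mulVec_eq]
  simp [symbolMatrix, symbolHankel, Matrix.mulVec, dotProduct, Matrix.kroneckerMap_apply,
    Fintype.sum_prod_type, Matrix.one_apply, mul_comm]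

theorem jacobianMatrix_mulVec {M N m : ℕ} (A : Fin (M + N - 1) → ℂ)
    (h : Fin N × Fin m → ℂ) (d : ParamIdx M N m → ℂ) :
    jacobianMatrix A h *ᵥ d
      = channelMatrix M h *ᵥ symbolPart d + channelMatrix M (channelPart d) *ᵥ A := by
  rw [channelMatrix_mulVec_eq A]
  exact Matrix.fromCols_mulVec _ _ _

theorem channelMatrix_add_smul_mulVec {M N m : ℕ} (A A' : Fin (M + N - 1) → ℂ)
    (h h' : Fin N × Fin m → ℂ) (t : ℂ) :
    channelMatrix M (h + t • h') *ᵥ (A + t • A')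
      = channelMatrix M h *ᵥ A + t • (channelMatrix M h *ᵥ A' + channelMatrix M h' *ᵥ A)
        + t ^ 2 • (channelMatrix M h' *ᵥ A') := by
  ext p
  simp only [Pi.add_apply, Pi.smul_apply, smul_eq_mul, channelMatrix_mulVec_apply,
    ← Finset.sum_add_distrib, Finset.mul_sum]
  exact Finset.sum_congr rfl fun i _ => by ring

/-! ### Second moments of the circular complex Gaussian law -/

section Moments

open MeasureTheory ComplexConjugate

theorem integral_exp_neg_mul_norm_sq {b : ℝ} (hb : 0 < b) :
    ∫ x : ℂ, Real.exp (-b * ‖x‖ ^ 2) = Real.pi / b := by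
  have h := Complex.integral_rpow_mul_exp_neg_mul_rpow (p := 2) (q := 0) (b := b)
    (by norm_num) (by norm_num) hb
  norm_num [Real.rpow_neg_one] at h
  simpa [div_eq_mul_inv] using h

theorem integral_norm_sq_mul_exp_neg_mul_norm_sq {b : ℝ} (hb : 0 < b) :
    ∫ x : ℂ, ‖x‖ ^ 2 * Real.exp (-b * ‖x‖ ^ 2) = Real.pi / b ^ 2 := by
  have h := Complex.integral_rpow_mul_exp_neg_mul_rpow (p := 2) (q := 2) (b := b)
    (by norm_num) (by norm_num) hb
  norm_num at h
  simpa [div_eq_mul_inv, Real.rpow_neg hb.le] using h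

/-- The Bochner integral of a nonintegrable function is `0` by convention, so a nonzero value
certifies integrability. -/
theorem integrable_exp_neg_mul_norm_sq {b : ℝ} (hb : 0 < b) :
    Integrable fun x : ℂ => Real.exp (-b * ‖x‖ ^ 2) :=
  Integrable.of_integral_ne_zero (by
    rw [integral_exp_neg_mul_norm_sq hb]; positivity)

theorem integrable_norm_sq_mul_exp_neg_mul_norm_sq {b : ℝ} (hb : 0 < b) :
    Integrable fun x : ℂ => ‖x‖ ^ 2 * Real.exp (-b * ‖x‖ ^ 2) :=
  Integrable.of_integral_ne_zero (by
    rw [integral_norm_sq_mul_exp_neg_mul_norm_sq hb]; positivity)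

theorem integrable_exp_neg_mul_norm_sq_mul {b : ℝ} (hb : 0 < b) {g : ℂ → ℂ} (hg : Continuous g)
    (hbound : ∀ x, ‖g x‖ ≤ 1 + ‖x‖ ^ 2) :
    Integrable fun x : ℂ => ((Real.exp (-b * ‖x‖ ^ 2) : ℝ) : ℂ) * g x := by
  refine ((integrable_exp_neg_mul_norm_sq hb).add
    (integrable_norm_sq_mul_exp_neg_mul_norm_sq hb)).mono' (by fun_prop) (ae_of_all _ fun x => ?_)
  rw [norm_mul, Complex.norm_real, Real.norm_of_nonneg (Real.exp_pos _).le]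
  have := mul_le_mul_of_nonneg_left (hbound x) (Real.exp_pos (-b * ‖x‖ ^ 2)).le
  simp only [Pi.add_apply]
  linarith

theorem integral_eq_zero_of_odd {g : ℂ → ℂ} (hg : ∀ x, g (-x) = -g x) : ∫ x, g x = 0 := by
  have h := integral_neg_eq_self g volume
  simp only [hg, integral_neg] at h
  exact self_eq_neg.mp h.symm

/-- The factor at coordinate `i` of the integrand `v_p v_q^*` under the Gaussian density. -/
noncomputable def gaussianMomentFactor {ι : Type*} [DecidableEq ι] (b : ℝ) (p q i : ι) (x : ℂ) : ℂ :=
  ((Real.exp (-b * ‖x‖ ^ 2) : ℝ) : ℂ) *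
    ((b / Real.pi : ℝ) * ((if i = p then x else 1) * (if i = q then conj x else 1)))

theorem integrable_gaussianMomentFactor {ι : Type*} [DecidableEq ι] {b : ℝ} (hb : 0 < b)
    (p q i : ι) : Integrable (gaussianMomentFactor b p q i) := by
  have key : Integrable fun x : ℂ => ((Real.exp (-b * ‖x‖ ^ 2) : ℝ) : ℂ) *
      ((if i = p then x else 1) * (if i = q then conj x else 1)) := by
    refine integrable_exp_neg_mul_norm_sq_mul hb ?_ ?_
    · split_ifs <;> fun_prop
    · intro x
      split_ifs <;> simp <;> nlinarith [sq_nonneg (‖x‖ - 1), norm_nonneg x]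
  refine (key.const_mul ((b / Real.pi : ℝ) : ℂ)).congr (ae_of_all _ fun x => ?_)
  simp only [gaussianMomentFactor]
  ring

theorem integral_gaussianMomentFactor {ι : Type*} [DecidableEq ι] {b : ℝ} (hb : 0 < b)
    (p q i : ι) : ∫ x, gaussianMomentFactor b p q i x
      = if i = p then (if i = q then ((b⁻¹ : ℝ) : ℂ) else 0) else (if i = q then 0 else 1) := by
  have hpi := Real.pi_pos.ne'
  rcases eq_or_ne i p with rfl | hp <;> rcases eq_or_ne i q with rfl | hq
  · have : ∀ x, gaussianMomentFactor b i i i x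
        = ((b / Real.pi * (‖x‖ ^ 2 * Real.exp (-b * ‖x‖ ^ 2)) : ℝ) : ℂ) := fun x => by
      simp only [gaussianMomentFactor, if_true, Complex.mul_conj, Complex.normSq_eq_norm_sq]
      push_cast
      ring
    rw [integral_congr_ae (ae_of_all _ this), integral_complex_ofReal, integral_const_mul,
      integral_norm_sq_mul_exp_neg_mul_norm_sq hb, if_pos rfl, if_pos rfl]
    congr 1
    field_simp
  · rw [integral_eq_zero_of_odd (fun x => by simp [gaussianMomentFactor, hq]), if_pos rfl,
      if_neg hq]
  · rw [integral_eq_zero_of_odd (fun x => by simp [gaussianMomentFactor, hp]), if_neg hp,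
      if_pos rfl]
  · have : ∀ x, gaussianMomentFactor b p q i x
        = ((b / Real.pi * Real.exp (-b * ‖x‖ ^ 2) : ℝ) : ℂ) := fun x => by
      simp only [gaussianMomentFactor, hp, hq, if_false]
      push_cast
      ring
    rw [integral_congr_ae (ae_of_all _ this), integral_complex_ofReal, integral_const_mul,
      integral_exp_neg_mul_norm_sq hb, if_neg hp, if_neg hq, ← Complex.ofReal_one]
    congr 1
    field_simp

/-- The density of the circular white complex Gaussian law with mean `0` and variance `b⁻¹`. -/
noncomputable def whiteDensity {ι : Type*} [Fintype ι] (b : ℝ) (v : ι → ℂ) : ℝ :=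
  ∏ i, (b / Real.pi * Real.exp (-b * ‖v i‖ ^ 2))

/-- The factorisation over coordinates lets Fubini reduce every second moment to integrals over `ℂ`.
-/
theorem prod_gaussianMomentFactor {ι : Type*} [Fintype ι] [DecidableEq ι] (b : ℝ) (p q : ι)
    (v : ι → ℂ) :
    ∏ i, gaussianMomentFactor b p q i (v i) = whiteDensity b v * (v p * star (v q)) := by
  simp only [gaussianMomentFactor, whiteDensity, Finset.prod_mul_distrib, Finset.prod_ite_eq',
    Finset.mem_univ, if_true, Complex.ofReal_mul, Complex.ofReal_prod, starRingEnd_apply]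
  ring

theorem integrable_whiteDensity_mul {ι : Type*} [Fintype ι] [DecidableEq ι] {b : ℝ} (hb : 0 < b)
    (p q : ι) : Integrable fun v : ι → ℂ => (whiteDensity b v : ℂ) * (v p * star (v q)) := by
  simp only [← prod_gaussianMomentFactor]
  exact Integrable.fintype_prod fun i => integrable_gaussianMomentFactor hb p q i

theorem integral_whiteDensity_mul {ι : Type*} [Fintype ι] [DecidableEq ι] {b : ℝ} (hb : 0 < b)
    (p q : ι) : ∫ v : ι → ℂ, (whiteDensity b v : ℂ) * (v p * star (v q))
      = if p = q then ((b⁻¹ : ℝ) : ℂ) else 0 := by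
  simp only [← prod_gaussianMomentFactor]
  rw [integral_fintype_prod_volume_eq_prod]
  simp only [integral_gaussianMomentFactor hb]
  by_cases hpq : p = q
  · subst hpq
    rw [if_pos rfl, Finset.prod_eq_single p] <;> simp +contextual
  · rw [if_neg hpq]
    exact Finset.prod_eq_zero (Finset.mem_univ p) (by simp [hpq])

end Moments

/-! ### Likelihood and score -/

theorem likelihood_eq_whiteDensity {M N m : ℕ} {σ : ℝ} (hσ : 0 < σ) (θ : ParamIdx M N m → ℂ)
    (y : ObsIdx M m → ℂ) :
    likelihood σ θ y = whiteDensity (σ ^ 2)⁻¹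
      (y - channelMatrix M (channelPart θ) *ᵥ symbolPart θ) := by
  have hσ' : ((σ : ℂ) ^ 2) ≠ 0 := by exact_mod_cast (pow_pos hσ 2).ne'
  set v := y - channelMatrix M (channelPart θ) *ᵥ symbolPart θ with hv
  have hinv : (((σ : ℂ) ^ 2) • (1 : Matrix (ObsIdx M m) (ObsIdx M m) ℂ))⁻¹
      = ((σ : ℂ) ^ 2)⁻¹ • 1 := by
    apply Matrix.inv_eq_left_inv
    simp [smul_smul, hσ']
  have hdet : (((σ : ℂ) ^ 2) • (1 : Matrix (ObsIdx M m) (ObsIdx M m) ℂ)).det.re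
      = (σ ^ 2) ^ Fintype.card (ObsIdx M m) := by
    rw [Matrix.det_smul, Matrix.det_one, mul_one]
    exact_mod_cast Complex.ofReal_re _
  have hquad : (star v ⬝ᵥ ((((σ : ℂ) ^ 2)⁻¹ • (1 : Matrix (ObsIdx M m) (ObsIdx M m) ℂ)) *ᵥ v)).re
      = (σ ^ 2)⁻¹ * ∑ i, ‖v i‖ ^ 2 := by
    rw [Matrix.smul_mulVec, Matrix.one_mulVec, dotProduct_smul, smul_eq_mul]
    have : star v ⬝ᵥ v = ((∑ i, ‖v i‖ ^ 2 : ℝ) : ℂ) := by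
      simp [dotProduct, Complex.conj_mul']
    rw [this]
    exact_mod_cast Complex.ofReal_re _
  rw [likelihood, complexGaussianDensity, hinv, ← hv, hquad, hdet, whiteDensity,
    Finset.prod_mul_distrib, ← Real.exp_sum, Finset.prod_const, ← Finset.mul_sum, ← mul_pow,
    ← inv_pow, Finset.card_univ, neg_mul]
  congr 2
  rw [mul_inv, div_eq_mul_inv, mul_comm]

theorem log_whiteDensity {ι : Type*} [Fintype ι] {b : ℝ} (hb : 0 < b) (v : ι → ℂ) :
    Real.log (whiteDensity b v)
      = Fintype.card ι * Real.log (b / Real.pi) - b * ∑ i, ‖v i‖ ^ 2 := by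
  have hc : b / Real.pi ≠ 0 := (div_pos hb Real.pi_pos).ne'
  rw [whiteDensity, Real.log_prod fun i _ => mul_ne_zero hc (Real.exp_pos _).ne']
  simp only [Real.log_mul hc (Real.exp_pos _).ne', Real.log_exp, Finset.sum_add_distrib,
    Finset.sum_const, Finset.card_univ, nsmul_eq_mul, ← Finset.mul_sum]
  ring

theorem lineDeriv_log_likelihood {M N m : ℕ} {σ : ℝ} (hσ : 0 < σ) (A : Fin (M + N - 1) → ℂ)
    (h : Fin N × Fin m → ℂ) (d : ParamIdx M N m → ℂ) (y : ObsIdx M m → ℂ) :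
    lineDeriv ℝ (fun θ' => Real.log (likelihood σ θ' y)) (Sum.elim A h) d
      = 2 * (σ ^ 2)⁻¹ * ∑ p, (star ((y - channelMatrix M h *ᵥ A) p)
          * (jacobianMatrix A h *ᵥ d) p).re := by
  have hb : 0 < (σ ^ 2)⁻¹ := by positivity
  -- Along a line the residual is a quadratic polynomial in `t`; only its linear coefficient, minus
  -- the Jacobian applied to `d`, enters the derivative at `0`.
  have hcurve : ∀ (t : ℝ) (p), (y - channelMatrix M (channelPart (Sum.elim A h + t • d))
      *ᵥ symbolPart (Sum.elim A h + t • d)) p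
      = (y - channelMatrix M h *ᵥ A) p
        - ((t : ℂ) * (jacobianMatrix A h *ᵥ d) p
          + (t : ℂ) ^ 2 * (channelMatrix M (channelPart d) *ᵥ symbolPart d) p) := fun t p => by
    have e1 : channelPart (Sum.elim A h + t • d) = h + (t : ℂ) • channelPart d := by
      ext; simp [channelPart]
    have e2 : symbolPart (Sum.elim A h + t • d) = A + (t : ℂ) • symbolPart d := by
      ext; simp [symbolPart]
    rw [e1, e2, channelMatrix_add_smul_mulVec, ← jacobianMatrix_mulVec]
    simp only [Pi.sub_apply, Pi.add_apply, Pi.smul_apply, smul_eq_mul]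
    ring
  apply HasLineDerivAt.lineDeriv
  unfold HasLineDerivAt
  simp only [likelihood_eq_whiteDensity hσ, log_whiteDensity hb, hcurve]
  have hd : ∀ p : ObsIdx M m, HasDerivAt (fun t : ℝ => (y - channelMatrix M h *ᵥ A) p
        - ((t : ℂ) * (jacobianMatrix A h *ᵥ d) p
          + (t : ℂ) ^ 2 * (channelMatrix M (channelPart d) *ᵥ symbolPart d) p))
      (-(jacobianMatrix A h *ᵥ d) p) 0 := fun p => by
    have h1 : HasDerivAt (fun t : ℝ => (t : ℂ)) 1 0 := Complex.ofRealCLM.hasDerivAt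
    have h2 := ((h1.mul_const ((jacobianMatrix A h *ᵥ d) p)).add
      ((h1.pow 2).mul_const ((channelMatrix M (channelPart d) *ᵥ symbolPart d) p))).const_sub
      ((y - channelMatrix M h *ᵥ A) p)
    exact h2.congr_deriv (by simp)
  have hsum := ((HasDerivAt.fun_sum fun p (_ : p ∈ Finset.univ) => (hd p).norm_sq).const_mul
    ((σ ^ 2)⁻¹)).const_sub (Fintype.card (ObsIdx M m) * Real.log ((σ ^ 2)⁻¹ / Real.pi))
  convert hsum using 1
  rw [mul_comm (2 : ℝ), mul_assoc, ← mul_neg, ← Finset.sum_neg_distrib, Finset.mul_sum]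
  congr 1
  refine Finset.sum_congr rfl fun p _ => ?_
  simp [Complex.inner]
  ring

theorem conjDeriv_log_likelihood {M N m : ℕ} {σ : ℝ} (hσ : 0 < σ) (A : Fin (M + N - 1) → ℂ)
    (h : Fin N × Fin m → ℂ) (y : ObsIdx M m → ℂ) (k : ParamIdx M N m) :
    conjDeriv (fun θ' => Real.log (likelihood σ θ' y)) (Sum.elim A h) k
      = ((σ : ℂ) ^ 2)⁻¹ * ∑ p, star (jacobianMatrix A h p k)
          * (y - channelMatrix M h *ᵥ A) p := by
  rw [conjDeriv, lineDeriv_log_likelihood hσ, lineDeriv_log_likelihood hσ]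
  have hcol : ∀ (c : ℂ) (p), (jacobianMatrix A h *ᵥ Pi.single k c) p
      = jacobianMatrix A h p k * c := fun c p => by
    rw [Matrix.mulVec_single]; simp
  simp only [hcol]
  push_cast
  rw [mul_left_comm Complex.I, ← mul_add, Finset.mul_sum, ← Finset.sum_add_distrib,
    mul_assoc, ← mul_assoc, one_div, inv_mul_cancel₀ two_ne_zero, one_mul]
  congr 1
  refine Finset.sum_congr rfl fun p _ => ?_
  -- The directions `1` and `I` combine through `Re w + I Re (I w) = conj w`, which conjugates the
  -- Jacobian entry.
  apply Complex.ext <;> simp <;> ring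

theorem complexFIM_eq {M N m : ℕ} {σ : ℝ} (hσ : 0 < σ) (A : Fin (M + N - 1) → ℂ)
    (h : Fin N × Fin m → ℂ) :
    complexFIM (M := M) σ (Sum.elim A h)
      = ((σ : ℂ) ^ 2)⁻¹ • ((jacobianMatrix A h)ᴴ * jacobianMatrix A h) := by
  have hb : 0 < (σ ^ 2)⁻¹ := by positivity
  have hσ' : ((σ : ℂ) ^ 2) ≠ 0 := by exact_mod_cast (pow_pos hσ 2).ne'
  ext k l
  simp only [complexFIM, Matrix.of_apply, likelihood_eq_whiteDensity hσ]
  have hscore := fun y k => conjDeriv_log_likelihood hσ A h y k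
  simp only [likelihood_eq_whiteDensity hσ] at hscore
  simp only [hscore]
  set J := jacobianMatrix A h
  -- The integrand as a function of the noise; translation invariance of Lebesgue measure removes
  -- the mean.
  let F : (ObsIdx M m → ℂ) → ℂ := fun v => ∑ p, ∑ q,
    (((σ : ℂ) ^ 2)⁻¹ ^ 2 * (star (J p k) * J q l)) *
      ((whiteDensity (σ ^ 2)⁻¹ v : ℂ) * (v p * star (v q)))
  have h1 : ∀ y : ObsIdx M m → ℂ,
      whiteDensity (σ ^ 2)⁻¹ (y - channelMatrix M (channelPart (Sum.elim A h))
        *ᵥ symbolPart (Sum.elim A h)) •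
        (((σ : ℂ) ^ 2)⁻¹ * (∑ p, star (J p k) * (y - channelMatrix M h *ᵥ A) p)
          * star (((σ : ℂ) ^ 2)⁻¹ * ∑ p, star (J p l) * (y - channelMatrix M h *ᵥ A) p))
      = F (y + -(channelMatrix M h *ᵥ A)) := fun y => by
    change whiteDensity (σ ^ 2)⁻¹ (y - channelMatrix M h *ᵥ A) • _ = _
    rw [← sub_eq_add_neg]
    simp only [F]
    simp only [star_mul', star_sum, Complex.real_smul, star_inv₀, star_pow,
      Complex.star_def, Complex.conj_ofReal, Complex.conj_conj]
    rw [show ∀ a b c d e : ℂ, a * (b * c * (d * e)) = (a * b * d) * (c * e) by intros; ring,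
      Finset.sum_mul_sum, Finset.mul_sum]
    refine Finset.sum_congr rfl fun p _ => ?_
    rw [Finset.mul_sum]
    exact Finset.sum_congr rfl fun q _ => by ring
  rw [MeasureTheory.integral_congr_ae (MeasureTheory.ae_of_all _ h1)]
  refine (MeasureTheory.integral_add_right_eq_self F _).trans ?_
  simp only [F]
  rw [MeasureTheory.integral_finsetSum]
  swap
  · exact fun p _ => MeasureTheory.integrable_finsetSum _ fun q _ =>
      (integrable_whiteDensity_mul hb p q).const_mul _
  have h2 : ∀ p, ∫ v : ObsIdx M m → ℂ, ∑ q, (((σ : ℂ) ^ 2)⁻¹ ^ 2 * (star (J p k) * J q l)) *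
          ((whiteDensity (σ ^ 2)⁻¹ v : ℂ) * (v p * star (v q)))
      = ((σ : ℂ) ^ 2)⁻¹ * (star (J p k) * J p l) := fun p => by
    rw [MeasureTheory.integral_finsetSum _ fun q _ =>
      (integrable_whiteDensity_mul hb p q).const_mul _]
    simp only [MeasureTheory.integral_const_mul]
    have := fun q => integral_whiteDensity_mul (ι := ObsIdx M m) hb p q
    simp only [this, mul_ite, mul_zero, Finset.sum_ite_eq, Finset.mem_univ, if_true]
    push_cast
    field_simp
  simp only [h2, Matrix.smul_apply, Matrix.mul_apply, Matrix.conjTranspose_apply, smul_eq_mul,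
    Finset.mul_sum]

/-! ### Perturbation of injective matrices -/

/-- An injective `B₀` is bounded below by some `1 / K`; a perturbation whose entries sum in norm to
less than `1 / (2K)` costs at most half of this bound. -/
theorem Matrix.exists_eventually_mul_norm_le_norm_mulVec {T ι κ : Type*} [Fintype ι] [Fintype κ]
    {l : Filter T} {B : T → Matrix ι κ ℂ} {B₀ : Matrix ι κ ℂ}
    (hB : Filter.Tendsto B l (𝓝 B₀)) (hinj : ∀ x, B₀ *ᵥ x = 0 → x = 0) :
    ∃ c > 0, ∀ᶠ t in l, ∀ x, c * ‖x‖ ≤ ‖B t *ᵥ x‖ := by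
  obtain ⟨K, hK, hlip⟩ := LinearMap.exists_antilipschitzWith B₀.mulVecLin
    (LinearMap.ker_eq_bot'.2 hinj)
  have hK' : (0 : ℝ) < K := hK
  have hbound : ∀ x, ‖x‖ ≤ K * ‖B₀ *ᵥ x‖ := fun x => by
    simpa [dist_eq_norm] using hlip.le_mul_dist x 0
  have hsum : Filter.Tendsto (fun t => ∑ i, ∑ j, ‖B t i j - B₀ i j‖) l (𝓝 0) := by
    have hentry : ∀ i j, Filter.Tendsto (fun t => ‖B t i j - B₀ i j‖) l (𝓝 0) := fun i j => by
      have h1 : Filter.Tendsto (fun t => B t i j) l (𝓝 (B₀ i j)) :=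
        ((continuous_apply_apply i j).tendsto B₀).comp hB
      simpa using (h1.sub_const (B₀ i j)).norm
    simpa using tendsto_finsetSum Finset.univ fun i _ =>
      tendsto_finsetSum Finset.univ fun j _ => hentry i j
  refine ⟨(2 * (K : ℝ))⁻¹, by positivity, ?_⟩
  filter_upwards [hsum.eventually (gt_mem_nhds (show (0 : ℝ) < (2 * (K : ℝ))⁻¹ by positivity))]
    with t ht x
  have hdiff : ‖B t *ᵥ x - B₀ *ᵥ x‖ ≤ (2 * (K : ℝ))⁻¹ * ‖x‖ := by
    rw [← Matrix.sub_mulVec, pi_norm_le_iff_of_nonneg (by positivity)]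
    intro i
    calc ‖((B t - B₀) *ᵥ x) i‖ ≤ ∑ j, ‖(B t - B₀) i j * x j‖ := norm_sum_le _ _
      _ ≤ ∑ j, ‖B t i j - B₀ i j‖ * ‖x‖ := Finset.sum_le_sum fun j _ => by
          rw [norm_mul]
          exact mul_le_mul_of_nonneg_left (norm_le_pi_norm x j) (norm_nonneg _)
      _ = (∑ j, ‖B t i j - B₀ i j‖) * ‖x‖ := by rw [Finset.sum_mul]
      _ ≤ (2 * (K : ℝ))⁻¹ * ‖x‖ := by
          refine mul_le_mul_of_nonneg_right (le_trans ?_ ht.le) (norm_nonneg _)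
          exact Finset.single_le_sum (f := fun i => ∑ j, ‖B t i j - B₀ i j‖)
            (fun i _ => Finset.sum_nonneg fun j _ => norm_nonneg _) (Finset.mem_univ i)
  have h1 := norm_sub_norm_le (B₀ *ᵥ x) (B t *ᵥ x)
  rw [norm_sub_rev] at h1
  have h2 : (K : ℝ)⁻¹ * ‖x‖ ≤ ‖B₀ *ᵥ x‖ := by
    rw [inv_mul_le_iff₀ hK']; exact hbound x
  have h3 : (2 * (K : ℝ))⁻¹ * ‖x‖ = (K : ℝ)⁻¹ * ‖x‖ - (2 * (K : ℝ))⁻¹ * ‖x‖ := by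
    rw [mul_inv]; ring
  linarith

theorem Matrix.eventually_mulVec_eq_zero_imp {T ι κ : Type*} [Fintype ι] [Fintype κ]
    {l : Filter T} {B : T → Matrix ι κ ℂ} {B₀ : Matrix ι κ ℂ}
    (hB : Filter.Tendsto B l (𝓝 B₀)) (hinj : ∀ x, B₀ *ᵥ x = 0 → x = 0) :
    ∀ᶠ t in l, ∀ x, B t *ᵥ x = 0 → x = 0 := by
  obtain ⟨c, hc, h⟩ := Matrix.exists_eventually_mul_norm_le_norm_mulVec hB hinj
  filter_upwards [h] with t ht x hx
  have := ht x
  rw [hx, norm_zero] at this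
  exact norm_le_zero_iff.1 (nonpos_of_mul_nonpos_right this hc)

/-- Solutions of perturbed injective systems are stable. -/
theorem Matrix.tendsto_of_tendsto_mulVec {T ι κ : Type*} [Fintype ι] [Fintype κ]
    {l : Filter T} {B : T → Matrix ι κ ℂ} {B₀ : Matrix ι κ ℂ}
    (hB : Filter.Tendsto B l (𝓝 B₀)) (hinj : ∀ x, B₀ *ᵥ x = 0 → x = 0)
    {x : T → κ → ℂ} {x₀ : κ → ℂ} (hx : ∀ᶠ t in l, B t *ᵥ x t = B₀ *ᵥ x₀) :
    Filter.Tendsto x l (𝓝 x₀) := by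
  obtain ⟨c, hc, h⟩ := Matrix.exists_eventually_mul_norm_le_norm_mulVec hB hinj
  have hlim : Filter.Tendsto (fun t => c⁻¹ * ‖B₀ *ᵥ x₀ - B t *ᵥ x₀‖) l (𝓝 0) := by
    have h1 : Filter.Tendsto (fun t => B t *ᵥ x₀) l (𝓝 (B₀ *ᵥ x₀)) :=
      ((continuous_id.matrix_mulVec continuous_const).tendsto B₀).comp hB
    simpa using ((h1.const_sub (B₀ *ᵥ x₀)).norm).const_mul c⁻¹
  rw [tendsto_iff_norm_sub_tendsto_zero]
  refine squeeze_zero' (Filter.Eventually.of_forall fun t => norm_nonneg _) ?_ hlim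
  filter_upwards [h, hx] with t ht hxt
  have := ht (x t - x₀)
  rw [Matrix.mulVec_sub, hxt] at this
  rwa [le_inv_mul_iff₀ hc]

/-! ### A one-dimensional kernel gives local identifiability -/

/-- At `y` equal to the mean of `θ`, the two log densities differ by a positive multiple of the
squared distance of the means. -/
theorem likelihood_eq_iff {M N m : ℕ} {σ : ℝ} (hσ : 0 < σ) (θ θ' : ParamIdx M N m → ℂ) :
    (∀ y : ObsIdx M m → ℂ, likelihood σ θ y = likelihood σ θ' y) ↔
      channelMatrix M (channelPart θ) *ᵥ symbolPart θ
        = channelMatrix M (channelPart θ') *ᵥ symbolPart θ' := by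
  have hb : 0 < (σ ^ 2)⁻¹ := by positivity
  simp only [likelihood_eq_whiteDensity hσ]
  refine ⟨fun h => ?_, fun h => by simp [h]⟩
  have h1 := congrArg Real.log (h (channelMatrix M (channelPart θ) *ᵥ symbolPart θ))
  rw [log_whiteDensity hb, log_whiteDensity hb] at h1
  simp only [sub_self, Pi.zero_apply, norm_zero, ne_eq, OfNat.ofNat_ne_zero, not_false_eq_true,
    zero_pow, Finset.sum_const_zero, mul_zero, sub_zero] at h1
  have h2 : ∑ i, ‖(channelMatrix M (channelPart θ) *ᵥ symbolPart θ
      - channelMatrix M (channelPart θ') *ᵥ symbolPart θ') i‖ ^ 2 = 0 := by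
    have : (σ ^ 2)⁻¹ * ∑ i, ‖(channelMatrix M (channelPart θ) *ᵥ symbolPart θ
      - channelMatrix M (channelPart θ') *ᵥ symbolPart θ') i‖ ^ 2 = 0 := by linarith
    exact (mul_eq_zero.1 this).resolve_left hb.ne'
  rw [Finset.sum_eq_zero_iff_of_nonneg fun i _ => by positivity] at h2
  ext i
  have := h2 i (Finset.mem_univ i)
  rwa [sq_eq_zero_iff, norm_eq_zero, Pi.sub_apply, sub_eq_zero] at this

theorem jacobianMatrix_mulVec_scale {M N m : ℕ} (A : Fin (M + N - 1) → ℂ)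
    (h : Fin N × Fin m → ℂ) : jacobianMatrix A h *ᵥ (Sum.elim (-A) h) = 0 := by
  rw [jacobianMatrix_mulVec]
  change channelMatrix M h *ᵥ (-A) + channelMatrix M h *ᵥ A = 0
  rw [Matrix.mulVec_neg, neg_add_cancel]

theorem jacobianMatrix_zero {M N m : ℕ} :
    jacobianMatrix (0 : Fin (M + N - 1) → ℂ) (0 : Fin N × Fin m → ℂ) = 0 := by
  ext p k
  rcases k with k | k <;>
    simp [jacobianMatrix, channelMatrix, symbolMatrix, symbolHankel, Matrix.kroneckerMap_apply]

/-- At `A = 0`, `h = 0` the Jacobian vanishes, and its kernel has dimension `M + N - 1 + N m ≥ 2`.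
-/
theorem scaleDirection_ne_zero {M N m : ℕ} (hM : 1 ≤ M) (hN : 1 ≤ N) (hm : 1 ≤ m)
    {A : Fin (M + N - 1) → ℂ} {h : Fin N × Fin m → ℂ}
    (hker : Module.finrank ℂ (LinearMap.ker (jacobianMatrix A h).mulVecLin) = 1) :
    (Sum.elim (-A) h : ParamIdx M N m → ℂ) ≠ 0 := by
  intro h0
  have hA : A = 0 := by
    ext s; simpa using congrFun h0 (Sum.inl s)
  have hh : h = 0 := by
    ext s; simpa using congrFun h0 (Sum.inr s)
  rw [hA, hh, jacobianMatrix_zero, Matrix.mulVecLin_zero, LinearMap.ker_zero, finrank_top,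
    Module.finrank_fintype_fun_eq_card, Fintype.card_sum, Fintype.card_prod, Fintype.card_fin,
    Fintype.card_fin, Fintype.card_fin] at hker
  have := Nat.mul_pos hN hm
  omega

theorem ker_jacobianMatrix_eq_span {M N m : ℕ} (hM : 1 ≤ M) (hN : 1 ≤ N) (hm : 1 ≤ m)
    {A : Fin (M + N - 1) → ℂ} {h : Fin N × Fin m → ℂ}
    (hker : Module.finrank ℂ (LinearMap.ker (jacobianMatrix A h).mulVecLin) = 1) :
    LinearMap.ker (jacobianMatrix A h).mulVecLin
      = Submodule.span ℂ {(Sum.elim (-A) h : ParamIdx M N m → ℂ)} := by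
  refine (Submodule.eq_of_le_of_finrank_eq ?_ ?_).symm
  · rw [Submodule.span_singleton_le_iff_mem]
    exact jacobianMatrix_mulVec_scale A h
  · rw [hker, finrank_span_singleton (scaleDirection_ne_zero hM hN hm hker)]

/-- The bilinear structure turns a difference of two noiseless observations into a value of the
Jacobian at the midpoint. -/
theorem jacobianMatrix_midpoint_mulVec {M N m : ℕ} (θ θ' : ParamIdx M N m → ℂ) :
    jacobianMatrix (symbolPart ((2 : ℂ)⁻¹ • (θ + θ'))) (channelPart ((2 : ℂ)⁻¹ • (θ + θ')))
        *ᵥ (θ' - θ)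
      = channelMatrix M (channelPart θ') *ᵥ symbolPart θ'
        - channelMatrix M (channelPart θ) *ᵥ symbolPart θ := by
  rw [jacobianMatrix_mulVec]
  ext p
  simp only [Pi.add_apply, Pi.sub_apply, channelMatrix_mulVec_apply, ← Finset.sum_add_distrib,
    ← Finset.sum_sub_distrib, symbolPart, channelPart, Pi.smul_apply, smul_eq_mul]
  exact Finset.sum_congr rfl fun i _ => by ring

theorem continuous_jacobianMatrix {M N m : ℕ} :
    Continuous fun θ : ParamIdx M N m → ℂ => jacobianMatrix (symbolPart θ) (channelPart θ) := by
  refine continuous_matrix fun p k => ?_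
  rcases k with k | k
  · simp only [jacobianMatrix, channelMatrix, Matrix.fromCols_apply_inl, Matrix.of_apply,
      channelPart]
    refine continuous_finsetSum _ fun i _ => ?_
    split_ifs <;> fun_prop
  · simp only [jacobianMatrix, symbolMatrix, symbolHankel, Matrix.fromCols_apply_inr,
      Matrix.of_apply, Matrix.kroneckerMap_apply, symbolPart]
    fun_prop

theorem locallyBlindlyIdentifiable_of_finrank_ker_eq_one {M N m : ℕ} (hM : 1 ≤ M) (hN : 1 ≤ N)
    (hm : 1 ≤ m) {σ : ℝ} (hσ : 0 < σ) (A : Fin (M + N - 1) → ℂ) (h : Fin N × Fin m → ℂ)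
    (hker : Module.finrank ℂ (LinearMap.ker (jacobianMatrix A h).mulVecLin) = 1) :
    LocallyBlindlyIdentifiable (M := M) σ (Sum.elim A h) := by
  set θ : ParamIdx M N m → ℂ := Sum.elim A h with hθ
  obtain ⟨k, hk⟩ : ∃ k, θ k ≠ 0 := by
    by_contra! hall
    refine scaleDirection_ne_zero hM hN hm hker (funext fun k => ?_)
    rcases k with s | s
    · simpa [hθ] using hall (Sum.inl s)
    · simpa [hθ] using hall (Sum.inr s)
  -- The extra row reads off coordinate `k`, where the scale direction does not vanish, so the
  -- augmented Jacobian is injective at `θ`.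
  let B : (ParamIdx M N m → ℂ) → Matrix (ObsIdx M m ⊕ Unit) (ParamIdx M N m) ℂ := fun θ₁ =>
    Matrix.fromRows (jacobianMatrix (symbolPart θ₁) (channelPart θ₁))
      (Matrix.of fun _ => Pi.single k 1)
  have hBcont : Continuous B := by
    refine continuous_matrix fun p l => ?_
    rcases p with p | p
    · exact continuous_jacobianMatrix.matrix_elem p l
    · exact continuous_const
  have hBker : ∀ θ₁ x, B θ₁ *ᵥ x = 0 ↔
      jacobianMatrix (symbolPart θ₁) (channelPart θ₁) *ᵥ x = 0 ∧ x k = 0 := fun θ₁ x => by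
    have hrow : ((Matrix.of fun _ : Unit => (Pi.single k 1 : ParamIdx M N m → ℂ)) *ᵥ x) ()
        = x k := by
      simp [Matrix.mulVec]
    rw [Matrix.fromRows_mulVec]
    constructor
    · intro h0
      exact ⟨funext fun p => congrFun h0 (Sum.inl p), hrow ▸ congrFun h0 (Sum.inr ())⟩
    · rintro ⟨h1, h2⟩
      funext p
      rcases p with p | p
      · exact congrFun h1 p
      · exact hrow.trans h2
  have hBinj : ∀ x, B θ *ᵥ x = 0 → x = 0 := fun x hx => by
    obtain ⟨h1, h2⟩ := (hBker θ x).1 hx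
    have hmem : x ∈ LinearMap.ker (jacobianMatrix A h).mulVecLin := h1
    rw [ker_jacobianMatrix_eq_span hM hN hm hker, Submodule.mem_span_singleton] at hmem
    obtain ⟨c, rfl⟩ := hmem
    have hc : c = 0 := by
      rcases k with s | s
      · simpa [show A s ≠ 0 from hk] using h2
      · simpa [show h s ≠ 0 from hk] using h2
    rw [hc, zero_smul]
  -- The scale factor is chosen so that `S θ'` agrees with `θ` at coordinate `k`; channel
  -- coordinates are scaled by the inverse, hence the inverted quotient.
  let β : (ParamIdx M N m → ℂ) → ℂ := fun θ' =>
    Sum.elim (fun _ => θ k / θ' k) (fun _ => θ' k / θ k) k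
  let S : (ParamIdx M N m → ℂ) → (ParamIdx M N m → ℂ) := fun θ' =>
    Sum.elim (β θ' • symbolPart θ') ((β θ')⁻¹ • channelPart θ')
  have hβθ : β θ = 1 := by
    simp only [β]; rcases k with s | s <;> simp [hk]
  have hβcont : ContinuousAt β θ := by
    simp only [β]
    rcases k with s | s
    · exact continuousAt_const.div (continuous_apply _).continuousAt hk
    · exact (continuous_apply _).continuousAt.div continuousAt_const hk
  have hSθ : S θ = θ := by
    simp only [S, hβθ, inv_one, one_smul]
    ext (s | s) <;> rfl
  have hScont : ContinuousAt S θ := by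
    refine continuousAt_pi.2 fun l => ?_
    rcases l with s | s
    · exact hβcont.mul (continuous_apply (Sum.inl s)).continuousAt
    · exact (hβcont.inv₀ (by simp [hβθ])).mul (continuous_apply (Sum.inr s)).continuousAt
  have hmid : Filter.Tendsto (fun θ' => B ((2 : ℂ)⁻¹ • (θ + S θ'))) (𝓝 θ) (𝓝 (B θ)) := by
    refine (hBcont.tendsto θ).comp ?_
    have : Filter.Tendsto (fun θ' => (2 : ℂ)⁻¹ • (θ + S θ')) (𝓝 θ)
        (𝓝 ((2 : ℂ)⁻¹ • (θ + S θ))) := (hScont.tendsto.const_add θ).const_smul _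
    have h2 : (2 : ℂ)⁻¹ • (θ + S θ) = θ := by
      rw [hSθ, ← two_smul ℂ θ, smul_smul]; norm_num
    rwa [h2] at this
  have hne : ∀ᶠ θ' in 𝓝 θ, θ' k ≠ 0 :=
    (continuous_apply k).continuousAt.eventually_ne hk
  refine ⟨_, Filter.inter_mem (Matrix.eventually_mulVec_eq_zero_imp hmid hBinj) hne, ?_⟩
  rintro θ' ⟨hinj, hk'⟩ hlik
  replace hk' : θ' k ≠ 0 := hk'
  rw [likelihood_eq_iff hσ] at hlik
  have hβ : β θ' ≠ 0 := by
    simp only [β]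
    rcases k with s | s
    · exact div_ne_zero hk hk'
    · exact div_ne_zero hk' hk
  have hmean : channelMatrix M (channelPart (S θ')) *ᵥ symbolPart (S θ')
      = channelMatrix M (channelPart θ') *ᵥ symbolPart θ' := by
    ext p
    simp only [channelMatrix_mulVec_apply, S, symbolPart, channelPart, Sum.elim_inl, Sum.elim_inr,
      Pi.smul_apply, smul_eq_mul]
    refine Finset.sum_congr rfl fun i _ => ?_
    field_simp
  have hzero : S θ' - θ = 0 := hinj _ ((hBker _ _).2
    ⟨by rw [jacobianMatrix_midpoint_mulVec, hmean, hlik, sub_self], by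
      simp only [S, β, Pi.sub_apply]
      rcases k with s | s
      · simp [symbolPart, hk']
      · simp [channelPart, hk']⟩)
  have hS : S θ' = θ := sub_eq_zero.1 hzero
  refine ⟨(β θ')⁻¹, inv_ne_zero hβ, ?_, ?_⟩
  · ext s
    have := congrFun hS (Sum.inl s)
    simp only [S, Sum.elim_inl, Pi.smul_apply, smul_eq_mul] at this
    simp only [Pi.smul_apply, smul_eq_mul, symbolPart] at this ⊢
    rw [← this, inv_mul_cancel_left₀ hβ]
  · ext s
    have := congrFun hS (Sum.inr s)
    simp only [S, Sum.elim_inr, Pi.smul_apply, smul_eq_mul] at this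
    simp only [Pi.smul_apply, smul_eq_mul, channelPart, inv_inv] at this ⊢
    rw [← this, mul_inv_cancel_left₀ hβ]

/-! ### Apolar pairs of a linear functional on polynomials of bounded degree -/

section Apolar

open Polynomial

variable {K : Type*} [Field K]

theorem Polynomial.mem_degreeLT_of_natDegree_lt {p : K[X]} {n : ℕ} (h : p.natDegree < n) :
    p ∈ degreeLT K n :=
  mem_degreeLT.2 (degree_le_natDegree.trans_lt (by exact_mod_cast h))

theorem Polynomial.natDegree_lt_of_mem_degreeLT {p : K[X]} {n : ℕ} (h : p ∈ degreeLT K n)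
    (hp : p ≠ 0) : p.natDegree < n :=
  (natDegree_lt_iff_degree_lt hp).2 (mem_degreeLT.1 h)

theorem Polynomial.mul_mem_degreeLT {p q : K[X]} {m n k : ℕ} (hp : p ∈ degreeLT K (m + 1))
    (hq : q ∈ degreeLT K n) (hk : m + n ≤ k) : p * q ∈ degreeLT K k := by
  rcases eq_or_ne p 0 with rfl | hp0
  · simp
  rcases eq_or_ne q 0 with rfl | hq0
  · simp
  have h1 := natDegree_lt_of_mem_degreeLT hp hp0
  have h2 := natDegree_lt_of_mem_degreeLT hq hq0
  exact mem_degreeLT_of_natDegree_lt (by rw [natDegree_mul hp0 hq0]; omega)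

theorem Polynomial.X_pow_mem_degreeLT {i n : ℕ} (h : i < n) : (X ^ i : K[X]) ∈ degreeLT K n :=
  mem_degreeLT_of_natDegree_lt (by simpa using h)

theorem Polynomial.map_eq_zero_of_forall_X_pow {V : Type*} [AddCommGroup V] [Module K V]
    (f : K[X] →ₗ[K] V) {n : ℕ} (h : ∀ i < n, f (X ^ i) = 0) {p : K[X]} (hp : p ∈ degreeLT K n) :
    f p = 0 := by
  classical
  rw [degreeLT_eq_span_X_pow] at hp
  refine (Submodule.span_le (p := LinearMap.ker f)).2 ?_ hp
  intro x hx
  simp only [Finset.coe_image, Set.mem_image, Finset.coe_range, Set.mem_Iio] at hx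
  obtain ⟨i, hi, rfl⟩ := hx
  exact h i hi

theorem Polynomial.finrank_degreeLT (n : ℕ) : Module.finrank K (degreeLT K n) = n := by
  rw [(degreeLTEquiv K n).finrank_eq, Module.finrank_fin_fun]

instance Polynomial.finiteDimensional_degreeLT (n : ℕ) : FiniteDimensional K (degreeLT K n) :=
  (degreeLTEquiv K n).symm.finiteDimensional

/-- The multiples `q X^i`, `i < m`, of a polynomial `q` of degree less than `n`, evaluated at a
functional. -/
noncomputable def shiftedValues (φ : K[X] →ₗ[K] K) (n m : ℕ) : degreeLT K n →ₗ[K] (Fin m → K) :=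
  LinearMap.pi fun i => φ ∘ₗ LinearMap.mulRight K (X ^ (i : ℕ)) ∘ₗ (degreeLT K n).subtype

theorem mem_ker_shiftedValues {φ : K[X] →ₗ[K] K} {n m : ℕ} {q : degreeLT K n} :
    q ∈ LinearMap.ker (shiftedValues φ n m) ↔ ∀ p ∈ degreeLT K m, φ (q * p) = 0 := by
  constructor
  · intro hq p hp
    refine map_eq_zero_of_forall_X_pow (φ ∘ₗ LinearMap.mulLeft K (q : K[X])) (fun i hi => ?_) hp
    exact congrFun (LinearMap.mem_ker.1 hq) ⟨i, hi⟩
  · intro h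
    ext i
    exact h _ (X_pow_mem_degreeLT i.2)

/-- A pair of polynomials generating the annihilator of the functional `φ` on polynomials of degree
at most `a + b`. -/
structure IsApolarPair (φ : K[X] →ₗ[K] K) (a b : ℕ) (q₁ q₂ : K[X]) : Prop where
  le : a ≤ b
  -- `degreeLT K n` means degree below `n`: the generators have degrees at most `a + 1` and `b + 1`,
  -- and every product tested below has degree at most `a + b`.
  left_mem : q₁ ∈ degreeLT K (a + 2)
  right_mem : q₂ ∈ degreeLT K (b + 2)
  left_ne_zero : q₁ ≠ 0
  left_annihilates : ∀ p ∈ degreeLT K b, φ (q₁ * p) = 0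
  right_annihilates : ∀ p ∈ degreeLT K a, φ (q₂ * p) = 0
  minimal : ∀ q ∈ degreeLT K (a + 1), (∀ p ∈ degreeLT K (b + 1), φ (q * p) = 0) → q = 0
  not_multiple : ∀ p ∈ degreeLT K (b - a + 1), q₂ ≠ q₁ * p

/-- `q₁` is an annihilator of least degree bound `a + 1`, found by counting equations. Annihilators
of degree at most `b + 1` form a space of dimension at least `b + 2 - a`, one more than the
multiples of `q₁` can fill, which leaves room for `q₂`. -/
theorem exists_isApolarPair (φ : K[X] →ₗ[K] K) {P : ℕ} (hφ : ∃ p ∈ degreeLT K P, φ p ≠ 0) :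
    ∃ a b q₁ q₂, a + b + 1 = P ∧ IsApolarPair φ a b q₁ q₂ := by
  classical
  let D : ℕ → Prop := fun k => ∃ q : K[X], q ≠ 0 ∧ q ∈ degreeLT K (k + 1) ∧
    ∀ p ∈ degreeLT K (P - k), φ (q * p) = 0
  have hexists : ∀ n m, m < n → ∃ q : K[X], q ≠ 0 ∧ q ∈ degreeLT K n ∧
      ∀ p ∈ degreeLT K m, φ (q * p) = 0 := fun n m hmn => by
    have hne : LinearMap.ker (shiftedValues φ n m) ≠ ⊥ :=
      LinearMap.ker_ne_bot_of_finrank_lt (by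
        rw [Module.finrank_fin_fun, finrank_degreeLT]; exact hmn)
    obtain ⟨q, hq, hq0⟩ := Submodule.exists_mem_ne_zero_of_ne_bot hne
    exact ⟨q, by simpa using hq0, q.2, mem_ker_shiftedValues.1 hq⟩
  have hmid : D ((P + 1) / 2) := hexists _ _ (by omega)
  have hzero : ¬ D 0 := by
    rintro ⟨q, hq0, hq, hkill⟩
    obtain ⟨p, hp, hp0⟩ := hφ
    have hdeg := natDegree_lt_of_mem_degreeLT hq hq0
    have hC : q = C (q.coeff 0) := eq_C_of_natDegree_eq_zero (by omega)
    have hc : q.coeff 0 ≠ 0 := fun h => hq0 (by rw [hC, h, C_0])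
    have := hkill p hp
    rw [hC, ← smul_eq_C_mul, map_smul, smul_eq_mul] at this
    exact hp0 ((mul_eq_zero.1 this).resolve_left hc)
  have hex : ∃ k, D k := ⟨_, hmid⟩
  obtain ⟨a, ha⟩ : ∃ a, Nat.find hex = a + 1 :=
    Nat.exists_eq_succ_of_ne_zero fun h => hzero (h ▸ Nat.find_spec hex)
  have hle : a + 1 ≤ (P + 1) / 2 := ha ▸ Nat.find_min' hex hmid
  obtain ⟨b, hb⟩ : ∃ b, a + b + 1 = P := ⟨P - (a + 1), by omega⟩
  obtain ⟨q₁, hq0, hq1, hkill⟩ := Nat.find_spec hex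
  rw [ha] at hq1 hkill
  have hmin : ∀ q ∈ degreeLT K (a + 1), (∀ p ∈ degreeLT K (b + 1), φ (q * p) = 0) → q = 0 := by
    intro q hq hk
    by_contra hne
    refine Nat.find_min hex (m := a) (by omega) ⟨q, hne, hq, ?_⟩
    rwa [show P - a = b + 1 by omega]
  rw [show P - (a + 1) = b by omega] at hkill
  obtain ⟨q₂, hq2, hkill2, hnot⟩ : ∃ q₂ ∈ degreeLT K (b + 2),
      (∀ p ∈ degreeLT K a, φ (q₂ * p) = 0) ∧ ∀ p ∈ degreeLT K (b - a + 1), q₂ ≠ q₁ * p := by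
    by_contra! hcon
    let G := (degreeLT K (b - a + 1)).map (LinearMap.mulLeft K q₁)
    have hsub : (LinearMap.ker (shiftedValues φ (b + 2) a)).map (degreeLT K (b + 2)).subtype
        ≤ G := by
      rintro _ ⟨q, hq, rfl⟩
      obtain ⟨p, hp, he⟩ := hcon q q.2 (mem_ker_shiftedValues.1 hq)
      exact ⟨p, hp, he.symm⟩
    have h1 := Submodule.finrank_mono hsub
    rw [Submodule.finrank_map_subtype_eq] at h1
    have h2 : Module.finrank K G ≤ b - a + 1 :=
      (Submodule.finrank_map_le _ _).trans_eq (finrank_degreeLT _)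
    have h3 := LinearMap.finrank_range_add_finrank_ker (shiftedValues φ (b + 2) a)
    have h4 := Submodule.finrank_le (LinearMap.range (shiftedValues φ (b + 2) a))
    rw [Module.finrank_fin_fun] at h4
    rw [finrank_degreeLT] at h3
    omega
  exact ⟨a, b, q₁, q₂, hb, by omega, hq1, hq2, hq0, hkill, hkill2, hmin, hnot⟩

namespace IsApolarPair

variable {φ : K[X] →ₗ[K] K} {a b : ℕ} {q₁ q₂ : K[X]}

/-- The two generators have no common zero, at infinity included. -/
theorem eq_zero_of_mul_eq_mul (H : IsApolarPair φ a b q₁ q₂) {u v : K[X]}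
    (hu : u ∈ degreeLT K b) (hv : v ∈ degreeLT K a) (huv : q₁ * u = q₂ * v) : u = 0 ∧ v = 0 := by
  suffices hv0 : v = 0 by
    refine ⟨?_, hv0⟩
    rw [hv0, mul_zero] at huv
    exact (mul_eq_zero.1 huv).resolve_left H.left_ne_zero
  by_contra hv0
  have hq2 : q₂ ≠ 0 := fun h => H.not_multiple 0 (Submodule.zero_mem _) (by simpa using h)
  have hq1 := H.left_ne_zero
  have hu0 : u ≠ 0 := by
    rintro rfl
    rw [mul_zero] at huv
    exact (mul_ne_zero hq2 hv0) huv.symm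
  -- A nontrivial relation leaves a common factor `D` of degree at most `a`. It will be shown to
  -- annihilate all polynomials of degree at most `b`, against minimality.
  obtain ⟨D, β, α, hD0, hcop, hβ, hα⟩ : ∃ D β α : K[X], D ≠ 0 ∧ IsCoprime β α ∧
      q₁ = D * β ∧ q₂ = D * α := by
    classical
    have hD0 : EuclideanDomain.gcd q₁ q₂ ≠ 0 :=
      fun h => hq1 (EuclideanDomain.gcd_eq_zero_iff.1 h).1
    obtain ⟨β, hβ⟩ := EuclideanDomain.gcd_dvd_left q₁ q₂
    obtain ⟨α, hα⟩ := EuclideanDomain.gcd_dvd_right q₁ q₂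
    refine ⟨_, β, α, hD0, ⟨EuclideanDomain.gcdA q₁ q₂, EuclideanDomain.gcdB q₁ q₂, ?_⟩, hβ, hα⟩
    have hbez := EuclideanDomain.gcd_eq_gcd_ab q₁ q₂
    generalize EuclideanDomain.gcdA q₁ q₂ = x at *
    generalize EuclideanDomain.gcdB q₁ q₂ = y at *
    generalize EuclideanDomain.gcd q₁ q₂ = D at *
    apply mul_left_cancel₀ hD0
    rw [mul_one]
    conv_rhs => rw [hbez, hβ, hα]
    ring
  have hβ0 : β ≠ 0 := by rintro rfl; simp [hβ] at hq1
  have hα0 : α ≠ 0 := by rintro rfl; simp [hα] at hq2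
  have hred : β * u = α * v := by
    apply mul_left_cancel₀ hD0
    rw [← mul_assoc, ← mul_assoc, ← hβ, ← hα, huv]
  obtain ⟨c, rfl⟩ : β ∣ v := hcop.dvd_of_dvd_mul_left ⟨u, hred.symm⟩
  have huc : u = α * c := mul_left_cancel₀ hβ0 (by rw [hred]; ring)
  have hc0 : c ≠ 0 := by rintro rfl; simp at hv0
  have hβa : β.natDegree < a := by
    have := natDegree_lt_of_mem_degreeLT hv hv0
    rw [natDegree_mul hβ0 hc0] at this
    omega
  have hαb : α.natDegree < b := by
    have := natDegree_lt_of_mem_degreeLT hu hu0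
    rw [huc, natDegree_mul hα0 hc0] at this
    omega
  have hd1 : D.natDegree + β.natDegree < a + 2 := by
    rw [← natDegree_mul hD0 hβ0, ← hβ]
    exact natDegree_lt_of_mem_degreeLT H.left_mem hq1
  have hd2 : D.natDegree + α.natDegree < b + 2 := by
    rw [← natDegree_mul hD0 hα0, ← hα]
    exact natDegree_lt_of_mem_degreeLT H.right_mem hq2
  have hab := H.le
  obtain ⟨s, t, hst⟩ := hcop
  have hDdeg : D.natDegree < a + 1 ∧ (0 < β.natDegree ∨ b - a < α.natDegree) := by
    rcases Nat.eq_zero_or_pos β.natDegree with h0 | h0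
    -- For constant `β`, `q₁` divides `q₂`, and `not_multiple` forces the quotient to have degree
    -- above `b - a`.
    · have : b - a < α.natDegree := by
        by_contra! hle
        obtain ⟨k, hk⟩ : ∃ k, β = C k := ⟨_, eq_C_of_natDegree_eq_zero h0⟩
        have hk0 : k ≠ 0 := by rintro rfl; simp [hk] at hβ0
        refine H.not_multiple (C k⁻¹ * α) (mem_degreeLT_of_natDegree_lt ?_) ?_
        · rw [natDegree_C_mul (inv_ne_zero hk0)]; omega
        · rw [hα, hβ, hk, mul_assoc, ← mul_assoc (C k), ← C_mul, mul_inv_cancel₀ hk0, C_1, one_mul]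
      exact ⟨by omega, Or.inr this⟩
    · exact ⟨by omega, Or.inl h0⟩
  refine hD0 (H.minimal D (mem_degreeLT_of_natDegree_lt hDdeg.1) fun f hf => ?_)
  -- Then `D f = q₁ x + q₂ y`. The Bézout identity gives such a decomposition, and reducing one
  -- coefficient modulo `α` or `β` brings the degrees into range.
  suffices hdecomp : ∃ x ∈ degreeLT K b, ∃ y ∈ degreeLT K a, f = β * x + α * y by
    obtain ⟨x, hx, y, hy, rfl⟩ := hdecomp
    rw [mul_add, ← mul_assoc, ← mul_assoc, ← hβ, ← hα, map_add, H.left_annihilates x hx,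
      H.right_annihilates y hy, add_zero]
  have hfdeg : f.natDegree ≤ b := by
    rcases eq_or_ne f 0 with rfl | hf0
    · simp
    · exact Nat.lt_succ_iff.1 (natDegree_lt_of_mem_degreeLT hf hf0)
  rcases Nat.eq_zero_or_pos β.natDegree with h0 | h0
  · have hα1 : b - a < α.natDegree := hDdeg.2.resolve_left (by omega)
    set x := (f * s) % α with hx
    set y := f * t + β * ((f * s) / α) with hy
    have hdec : f = β * x + α * y := by
      have := EuclideanDomain.div_add_mod (f * s) α
      calc f = f * (s * β + t * α) := by rw [hst, mul_one]
        _ = β * (f * s) + f * t * α := by ring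
        _ = β * (α * (f * s / α) + (f * s) % α) + f * t * α := by rw [this]
        _ = _ := by rw [hx, hy]; ring
    have hxdeg : x.natDegree < α.natDegree :=
      natDegree_mod_lt _ (by omega)
    refine ⟨x, mem_degreeLT_of_natDegree_lt (by omega), y, ?_, hdec⟩
    rcases eq_or_ne y 0 with hy0 | hy0
    · simp [hy0]
    have hmul : α * y = f - β * x := by rw [hdec]; ring
    have h1 : (α * y).natDegree ≤ b := by
      rw [hmul]
      refine (natDegree_sub_le _ _).trans (max_le hfdeg ?_)
      have := natDegree_mul_le (p := β) (q := x)
      omega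
    rw [natDegree_mul hα0 hy0] at h1
    exact mem_degreeLT_of_natDegree_lt (by omega)
  · set y := (f * t) % β with hy
    set x := f * s + α * ((f * t) / β) with hx
    have hdec : f = β * x + α * y := by
      have := EuclideanDomain.div_add_mod (f * t) β
      calc f = f * (s * β + t * α) := by rw [hst, mul_one]
        _ = α * (f * t) + f * s * β := by ring
        _ = α * (β * (f * t / β) + (f * t) % β) + f * s * β := by rw [this]
        _ = _ := by rw [hx, hy]; ring
    have hydeg : y.natDegree < β.natDegree :=
      natDegree_mod_lt _ (by omega)
    refine ⟨x, ?_, y, mem_degreeLT_of_natDegree_lt (by omega), hdec⟩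
    rcases eq_or_ne x 0 with hx0 | hx0
    · simp [hx0]
    have hmul : β * x = f - α * y := by rw [hdec]; ring
    have h1 : (β * x).natDegree ≤ max b (α.natDegree + y.natDegree) := by
      rw [hmul]
      exact (natDegree_sub_le _ _).trans (max_le_max hfdeg natDegree_mul_le)
    rw [natDegree_mul hβ0 hx0] at h1
    exact mem_degreeLT_of_natDegree_lt (by
      rcases le_max_iff.1 h1 with h | h <;> omega)

/-- A functional annihilated by both generators is a multiple of `φ`. -/
theorem exists_eq_mul (H : IsApolarPair φ a b q₁ q₂)
    (hφ : ∃ p ∈ degreeLT K (a + b + 1), φ p ≠ 0) (ψ : K[X] →ₗ[K] K)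
    (h₁ : ∀ p ∈ degreeLT K b, ψ (q₁ * p) = 0) (h₂ : ∀ p ∈ degreeLT K a, ψ (q₂ * p) = 0) :
    ∃ c, ∀ p ∈ degreeLT K (a + b + 1), ψ p = c * φ p := by
  obtain ⟨p₀, hp₀, hp₀'⟩ := hφ
  let g : (degreeLT K b × degreeLT K a) →ₗ[K] K[X] :=
    LinearMap.coprod (LinearMap.mulLeft K q₁ ∘ₗ (degreeLT K b).subtype)
      (LinearMap.mulLeft K q₂ ∘ₗ (degreeLT K a).subtype)
  have hg : ∀ x, g x = q₁ * x.1 + q₂ * x.2 := fun x => rfl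
  have hinj : Function.Injective g := by
    rw [← LinearMap.ker_eq_bot, LinearMap.ker_eq_bot']
    rintro ⟨u, v⟩ huv
    rw [hg] at huv
    obtain ⟨h1, h2⟩ := H.eq_zero_of_mul_eq_mul u.2 (Submodule.neg_mem _ v.2)
      (by rw [mul_neg]; exact eq_neg_of_add_eq_zero_left huv)
    rw [neg_eq_zero] at h2
    exact Prod.ext (Subtype.ext h1) (Subtype.ext h2)
  let W := degreeLT K (a + b + 1) ⊓ LinearMap.ker φ
  have hgW : LinearMap.range g ≤ W := by
    rintro _ ⟨⟨u, v⟩, rfl⟩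
    rw [hg]
    refine ⟨Submodule.add_mem _ (mul_mem_degreeLT H.left_mem u.2 (by omega))
      (mul_mem_degreeLT H.right_mem v.2 (by omega)), ?_⟩
    change φ _ = 0
    rw [map_add, H.left_annihilates u u.2, H.right_annihilates v v.2, add_zero]
  have hWlt : W < degreeLT K (a + b + 1) :=
    lt_of_le_of_ne inf_le_left fun h => hp₀' ((h.symm ▸ hp₀ : p₀ ∈ W).2)
  have : FiniteDimensional K W := Submodule.finiteDimensional_of_le hWlt.le
  -- Injectivity gives the range dimension `a + b`, already that of a hyperplane in `degreeLT K (a +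
  -- b + 1)`.
  have hrange : LinearMap.range g = W := by
    refine Submodule.eq_of_le_of_finrank_le hgW ?_
    rw [LinearMap.finrank_range_of_inj hinj, Module.finrank_prod, finrank_degreeLT,
      finrank_degreeLT]
    have := Submodule.finrank_lt_finrank_of_lt hWlt
    rw [finrank_degreeLT] at this
    omega
  have hψW : ∀ p ∈ W, ψ p = 0 := by
    intro p hp
    rw [← hrange] at hp
    obtain ⟨⟨u, v⟩, rfl⟩ := hp
    rw [hg, map_add, h₁ u u.2, h₂ v v.2, add_zero]
  refine ⟨ψ p₀ / φ p₀, fun p hp => ?_⟩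
  have hmem : p - (φ p / φ p₀) • p₀ ∈ W := by
    refine ⟨Submodule.sub_mem _ hp (Submodule.smul_mem _ _ hp₀), ?_⟩
    change φ _ = 0
    rw [map_sub, map_smul, smul_eq_mul, div_mul_cancel₀ _ hp₀', sub_self]
  have := hψW _ hmem
  rw [map_sub, map_smul, smul_eq_mul, sub_eq_zero] at this
  rw [this]
  ring

/-- By minimality the pairing `(p, r) ↦ φ (p r)` embeds `degreeLT K a` into the dual of `degreeLT K
(b + 2)`, where a vector outside a subspace is separated from it by some `r`. -/
theorem exists_annihilating_of_lt (H : IsApolarPair φ a b q₁ q₂) {S : Submodule K K[X]}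
    (hS : ¬ degreeLT K a ≤ S) :
    ∃ r ∈ degreeLT K (b + 2), (∀ s ∈ S, s ∈ degreeLT K a → φ (r * s) = 0) ∧
      ∃ p ∈ degreeLT K a, φ (r * p) ≠ 0 := by
  obtain ⟨p₀, hp₀, hp₀S⟩ := SetLike.not_le_iff_exists.1 hS
  let ψ : degreeLT K a →ₗ[K] Module.Dual K (degreeLT K (b + 2)) :=
    ((LinearMap.mul K K[X]).compr₂ φ).domRestrict₁₂ (degreeLT K a) (degreeLT K (b + 2))
  have hψ : ∀ p r, ψ p r = φ (p * r) := fun p r => rfl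
  have hinj : Function.Injective ψ := by
    rw [← LinearMap.ker_eq_bot, LinearMap.ker_eq_bot']
    intro p hp
    refine Subtype.ext (H.minimal p (degreeLT_mono (by omega) p.2) fun f hf => ?_)
    exact LinearMap.congr_fun hp ⟨f, degreeLT_mono (by omega) hf⟩
  let W := (S.comap (degreeLT K a).subtype).map ψ
  have hnot : ψ ⟨p₀, hp₀⟩ ∉ W := by
    rintro ⟨p, hp, he⟩
    rw [hinj he] at hp
    exact hp₀S hp
  rw [← Subspace.dualCoannihilator_dualAnnihilator_eq (W := W), Submodule.mem_dualAnnihilator]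
    at hnot
  push Not at hnot
  obtain ⟨r, hr, hr0⟩ := hnot
  refine ⟨r, r.2, fun s hs hsa => ?_, p₀, hp₀, ?_⟩
  · rw [mul_comm]
    exact (Submodule.mem_dualCoannihilator r).1 hr (ψ ⟨s, hsa⟩) ⟨⟨s, hsa⟩, hs, rfl⟩
  · rw [mul_comm]
    exact hr0

end IsApolarPair

end Apolar

/-! ### Symbols as functionals on polynomials -/

section Deformation

open Polynomial

/-- The functional `X^s ↦ A_s` on polynomials. -/
noncomputable def symbolFunctional {P : ℕ} (A : Fin P → ℂ) : ℂ[X] →ₗ[ℂ] ℂ :=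
  ∑ s : Fin P, A s • lcoeff ℂ s

theorem symbolFunctional_apply {P : ℕ} (A : Fin P → ℂ) (p : ℂ[X]) :
    symbolFunctional A p = ∑ s : Fin P, p.coeff s * A s := by
  simp [symbolFunctional, mul_comm]

theorem symbolFunctional_X_pow {P : ℕ} (A : Fin P → ℂ) (s : Fin P) :
    symbolFunctional A (X ^ (s : ℕ)) = A s := by
  rw [symbolFunctional_apply, Finset.sum_eq_single s]
  · simp
  · intro s' _ hs
    rw [coeff_X_pow, if_neg fun h => hs (Fin.ext h), zero_mul]
  · simp

theorem exists_symbolFunctional_ne_zero {P : ℕ} {A : Fin P → ℂ} (hA : A ≠ 0) :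
    ∃ p ∈ degreeLT ℂ P, symbolFunctional A p ≠ 0 := by
  obtain ⟨s, hs⟩ := Function.ne_iff.1 hA
  exact ⟨X ^ (s : ℕ), X_pow_mem_degreeLT s.2, by rwa [symbolFunctional_X_pow]⟩

/-- The polynomial with coefficient vector `x`. -/
noncomputable def vecPoly {n : ℕ} (x : Fin n → ℂ) : ℂ[X] := ∑ i : Fin n, C (x i) * X ^ (i : ℕ)

theorem vecPoly_mem {n : ℕ} (x : Fin n → ℂ) : vecPoly x ∈ degreeLT ℂ n :=
  Submodule.sum_mem _ fun i _ => by
    rw [← smul_eq_C_mul]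
    exact Submodule.smul_mem _ _ (X_pow_mem_degreeLT i.2)

theorem coeff_vecPoly {n : ℕ} (x : Fin n → ℂ) (i : Fin n) : (vecPoly x).coeff i = x i := by
  simp only [vecPoly, finsetSum_coeff, coeff_C_mul, coeff_X_pow]
  rw [Finset.sum_eq_single i]
  · simp
  · intro j _ hj
    rw [if_neg fun h => hj (Fin.ext h).symm, mul_zero]
  · simp

theorem vecPoly_eq_zero {n : ℕ} {x : Fin n → ℂ} (h : vecPoly x = 0) : x = 0 := by
  ext i
  rw [← coeff_vecPoly x i, h]; simp

theorem vecPoly_coeff {n : ℕ} {q : ℂ[X]} (hq : q ∈ degreeLT ℂ n) :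
    vecPoly (fun i : Fin n => q.coeff i) = q := by
  ext k
  by_cases hk : k < n
  · exact coeff_vecPoly _ ⟨k, hk⟩
  · rw [coeff_eq_zero_of_degree_lt, coeff_eq_zero_of_degree_lt]
    · exact (mem_degreeLT.1 hq).trans_le (by exact_mod_cast not_lt.1 hk)
    · exact (mem_degreeLT.1 (vecPoly_mem _)).trans_le (by exact_mod_cast not_lt.1 hk)

theorem symbolHankel_mulVec_apply {M N : ℕ} (A : Fin (M + N - 1) → ℂ) (x : Fin N → ℂ)
    (r : Fin M) :
    (symbolHankel (M := M) A *ᵥ x) r = symbolFunctional A (X ^ (r : ℕ) * vecPoly x) := by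
  simp only [Matrix.mulVec, dotProduct, symbolHankel, Matrix.of_apply, vecPoly, Finset.mul_sum,
    map_sum]
  refine Finset.sum_congr rfl fun i _ => ?_
  rw [mul_left_comm, ← pow_add, ← smul_eq_C_mul, map_smul, smul_eq_mul, mul_comm]
  congr 1
  exact (symbolFunctional_X_pow A ⟨r + i, by omega⟩).symm

theorem channelMatrix_mulVec_eq_symbolHankel {M N m : ℕ} (A : Fin (M + N - 1) → ℂ)
    (h : Fin N × Fin m → ℂ) (p : ObsIdx M m) :
    (channelMatrix M h *ᵥ A) p = (symbolHankel (M := M) A *ᵥ fun i => h (i, p.2)) p.1 := by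
  rw [channelMatrix_mulVec_apply]
  simp [Matrix.mulVec, dotProduct, symbolHankel, mul_comm]

/-- The matrix whose rows are the first `n` coefficients of a family of polynomials. -/
def coeffMatrix {ι : Type*} (n : ℕ) (g : ι → ℂ[X]) : Matrix ι (Fin n) ℂ :=
  Matrix.of fun i s => (g i).coeff s

theorem coeffMatrix_mulVec {ι : Type*} {n : ℕ} (g : ι → ℂ[X]) (A : Fin n → ℂ) (i : ι) :
    (coeffMatrix n g *ᵥ A) i = symbolFunctional A (g i) := by
  rw [symbolFunctional_apply]; rfl

theorem coeffMatrix_mulVec_symbolHankel {ι : Type*} {M N : ℕ} {g : ι → ℂ[X]}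
    (hg : ∀ i, g i ∈ degreeLT ℂ M) (A : Fin (M + N - 1) → ℂ) (x : Fin N → ℂ) (i : ι) :
    (coeffMatrix M g *ᵥ (symbolHankel (M := M) A *ᵥ x)) i
      = symbolFunctional A (g i * vecPoly x) := by
  have hsum : (coeffMatrix M g *ᵥ (symbolHankel (M := M) A *ᵥ x)) i
      = ∑ r : Fin M, (g i).coeff r * (symbolHankel (M := M) A *ᵥ x) r := rfl
  rw [hsum]
  conv_rhs => rw [← vecPoly_coeff (hg i), vecPoly, Finset.sum_mul, map_sum]
  refine Finset.sum_congr rfl fun r _ => ?_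
  rw [symbolHankel_mulVec_apply, mul_assoc, ← smul_eq_C_mul, map_smul]
  rfl

theorem coeffMatrix_transpose_mulVec {ι : Type*} [Fintype ι] {n : ℕ} (g : ι → ℂ[X]) (x : ι → ℂ)
    (s : Fin n) : ((coeffMatrix n g)ᵀ *ᵥ x) s = (∑ i, C (x i) * g i).coeff s := by
  simp [Matrix.mulVec, dotProduct, coeffMatrix, finsetSum_coeff, mul_comm]

theorem tendsto_coeffMatrix {ι : Type*} {n : ℕ} (g r : ι → ℂ[X]) :
    Filter.Tendsto (fun t : ℂ => coeffMatrix n fun i => g i + C t * r i) (𝓝 0)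
      (𝓝 (coeffMatrix n g)) := by
  have hc : Continuous fun t : ℂ => coeffMatrix n fun i => g i + C t * r i := by
    refine continuous_matrix fun i s => ?_
    simp only [coeffMatrix, Matrix.of_apply, coeff_add, coeff_C_mul]
    fun_prop
  simpa using hc.tendsto 0

/-! ### Deformation of symbols and channels through the apolar pair -/

/-- Otherwise `q₁` has degree below `N` while `M ≤ b`, so its coefficient vector is a nonzero kernel
vector. -/
theorem le_of_symbolHankel_injective {M N a b : ℕ} {A : Fin (M + N - 1) → ℂ} {q₁ q₂ : ℂ[X]}
    (hinj : ∀ x, symbolHankel (M := M) (N := N) A *ᵥ x = 0 → x = 0)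
    (hP : a + b + 1 = M + N - 1) (H : IsApolarPair (symbolFunctional A) a b q₁ q₂) :
    N ≤ a + 1 := by
  by_contra! hlt
  have hq : q₁ ∈ degreeLT ℂ N := degreeLT_mono (by omega) H.left_mem
  have h0 := hinj (fun i => q₁.coeff i) (funext fun r => by
    rw [symbolHankel_mulVec_apply, vecPoly_coeff hq, mul_comm]
    exact H.left_annihilates _ (X_pow_mem_degreeLT (by omega)))
  apply H.left_ne_zero
  rw [← vecPoly_coeff hq, h0]
  simp [vecPoly]

/-- The equations of an apolar pair, with the second generator deformed, have full rank. -/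
theorem IsApolarPair.exists_symbols {P a b : ℕ} {A : Fin P → ℂ} {q₁ q₂ : ℂ[X]} (hA : A ≠ 0)
    (hP : a + b + 1 = P) (H : IsApolarPair (symbolFunctional A) a b q₁ q₂) (r : ℂ[X]) :
    ∃ A' : ℂ → Fin P → ℂ, Filter.Tendsto A' (𝓝 0) (𝓝 A) ∧ ∀ᶠ t in 𝓝 (0 : ℂ),
      (∀ p ∈ degreeLT ℂ b, symbolFunctional (A' t) (q₁ * p) = 0) ∧
      ∀ p ∈ degreeLT ℂ a, symbolFunctional (A' t) ((q₂ + C t * r) * p) = 0 := by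
  obtain ⟨s₀, hs₀⟩ := Function.ne_iff.1 hA
  -- The annihilation equations together with the normalising coordinate `s₀` form a square system,
  -- since `a + b + 1 = P`. It is invertible at `t = 0`, and keeping its right-hand side fixed
  -- preserves the zero rows.
  let g : (Fin b ⊕ Fin a) ⊕ Unit → ℂ[X] :=
    Sum.elim (Sum.elim (fun i => q₁ * X ^ (i : ℕ)) fun j => q₂ * X ^ (j : ℕ))
      fun _ => X ^ (s₀ : ℕ)
  let g' : (Fin b ⊕ Fin a) ⊕ Unit → ℂ[X] :=
    Sum.elim (Sum.elim (fun _ => 0) fun j => r * X ^ (j : ℕ)) fun _ => 0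
  have hlim := tendsto_coeffMatrix (n := P) g g'
  have hinj : ∀ x, coeffMatrix P g *ᵥ x = 0 → x = 0 := by
    intro x hx
    have hrow : ∀ i, symbolFunctional x (g i) = 0 := fun i => by
      rw [← coeffMatrix_mulVec, hx]; rfl
    obtain ⟨c, hc⟩ := H.exists_eq_mul (hP ▸ exists_symbolFunctional_ne_zero hA)
      (symbolFunctional x)
      (fun p hp => map_eq_zero_of_forall_X_pow (symbolFunctional x ∘ₗ LinearMap.mulLeft ℂ q₁)
        (fun i hi => hrow (Sum.inl (Sum.inl ⟨i, hi⟩))) hp)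
      (fun p hp => map_eq_zero_of_forall_X_pow (symbolFunctional x ∘ₗ LinearMap.mulLeft ℂ q₂)
        (fun i hi => hrow (Sum.inl (Sum.inr ⟨i, hi⟩))) hp)
    have hcs : ∀ s, x s = c * A s := fun s => by
      rw [← symbolFunctional_X_pow x, ← symbolFunctional_X_pow A]
      exact hc _ (X_pow_mem_degreeLT (by omega))
    have hx0 : x s₀ = 0 := by
      rw [← symbolFunctional_X_pow x]
      exact hrow (Sum.inr ())
    have hc0 : c = 0 := (mul_eq_zero.1 ((hcs s₀).symm.trans hx0)).resolve_right hs₀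
    ext s
    simp [hcs, hc0]
  have hsolve : ∀ᶠ t in 𝓝 (0 : ℂ), ∃ x, (coeffMatrix P fun i => g i + C t * g' i) *ᵥ x
      = coeffMatrix P g *ᵥ A := by
    filter_upwards [Matrix.eventually_mulVec_eq_zero_imp hlim hinj] with t ht
    have hsurj := (LinearMap.injective_iff_surjective_of_finrank_eq_finrank
      (f := (coeffMatrix P fun i => g i + C t * g' i).mulVecLin) (by
        simp only [Module.finrank_fintype_fun_eq_card, Fintype.card_sum, Fintype.card_fin,
          Fintype.card_unit]
        omega)).1 (LinearMap.ker_eq_bot.1 (LinearMap.ker_eq_bot'.2 ht))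
    exact hsurj _
  obtain ⟨A', hA'⟩ := hsolve.choice
  refine ⟨A', Matrix.tendsto_of_tendsto_mulVec hlim hinj hA', ?_⟩
  filter_upwards [hA'] with t ht
  have hrow : ∀ i, symbolFunctional (A' t) (g i + C t * g' i) = symbolFunctional A (g i) :=
    fun i => by
      have := congrFun ht i
      rwa [coeffMatrix_mulVec, coeffMatrix_mulVec] at this
  constructor
  · refine fun p hp => map_eq_zero_of_forall_X_pow
      (symbolFunctional (A' t) ∘ₗ LinearMap.mulLeft ℂ q₁) (fun i hi => ?_) hp
    have := hrow (Sum.inl (Sum.inl ⟨i, hi⟩))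
    simp only [g, g', Sum.elim_inl, mul_zero, add_zero] at this
    exact this.trans (H.left_annihilates _ (X_pow_mem_degreeLT hi))
  · refine fun p hp => map_eq_zero_of_forall_X_pow
      (symbolFunctional (A' t) ∘ₗ LinearMap.mulLeft ℂ (q₂ + C t * r)) (fun i hi => ?_) hp
    have := hrow (Sum.inl (Sum.inr ⟨i, hi⟩))
    simp only [g, g', Sum.elim_inl, Sum.elim_inr, ← mul_assoc, ← add_mul] at this
    exact this.trans (H.right_annihilates _ (X_pow_mem_degreeLT hi))

/-- Along symbols annihilated by a deformed apolar pair, the channel can be deformed so that the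
noiseless observation does not change. -/
theorem IsApolarPair.exists_channels {M N m a b : ℕ} {A : Fin (M + N - 1) → ℂ} {q₁ q₂ r : ℂ[X]}
    (hN : 1 ≤ N) (hinj : ∀ x, symbolHankel (M := M) (N := N) A *ᵥ x = 0 → x = 0)
    (hP : a + b + 1 = M + N - 1) (H : IsApolarPair (symbolFunctional A) a b q₁ q₂)
    (hr : r ∈ degreeLT ℂ (b + 2)) (h : Fin N × Fin m → ℂ)
    (hrh : ∀ c, ∀ j, j + N < a + 1 →
      symbolFunctional A (r * (X ^ j * vecPoly fun i => h (i, c))) = 0)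
    {A' : ℂ → Fin (M + N - 1) → ℂ} (hlim : Filter.Tendsto A' (𝓝 0) (𝓝 A))
    (hA' : ∀ᶠ t in 𝓝 (0 : ℂ), (∀ p ∈ degreeLT ℂ b, symbolFunctional (A' t) (q₁ * p) = 0) ∧
      ∀ p ∈ degreeLT ℂ a, symbolFunctional (A' t) ((q₂ + C t * r) * p) = 0) :
    ∃ h' : ℂ → Fin N × Fin m → ℂ, Filter.Tendsto h' (𝓝 0) (𝓝 h) ∧ ∀ᶠ t in 𝓝 (0 : ℂ),
      channelMatrix M (h' t) *ᵥ A' t = channelMatrix M h *ᵥ A := by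
  have hNa := le_of_symbolHankel_injective hinj hP H
  have hab := H.le
  obtain ⟨e, he⟩ : ∃ e, N + e = a + 1 := ⟨a + 1 - N, by omega⟩
  obtain ⟨f, hf⟩ : ∃ f, N + f = b + 1 := ⟨b + 1 - N, by omega⟩
  have hMef : M = N + e + f := by omega
  let g : Fin f ⊕ Fin e → ℂ[X] :=
    Sum.elim (fun i => q₁ * X ^ (i : ℕ)) fun j => q₂ * X ^ (j : ℕ)
  let g' : Fin f ⊕ Fin e → ℂ[X] := Sum.elim (fun _ => 0) fun j => r * X ^ (j : ℕ)
  have hgM : ∀ i, g i ∈ degreeLT ℂ M := by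
    rintro (i | i)
    · exact mul_mem_degreeLT H.left_mem (X_pow_mem_degreeLT i.2) (by omega)
    · exact mul_mem_degreeLT H.right_mem (X_pow_mem_degreeLT i.2) (by omega)
  have hgM' : ∀ i, g' i ∈ degreeLT ℂ M := by
    rintro (i | i)
    · exact Submodule.zero_mem _
    · exact mul_mem_degreeLT hr (X_pow_mem_degreeLT i.2) (by omega)
  have hgt : ∀ t i, g i + C t * g' i ∈ degreeLT ℂ M := fun t i => by
    rw [← smul_eq_C_mul]
    exact Submodule.add_mem _ (hgM i) (Submodule.smul_mem _ _ (hgM' i))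
  have hKlim : Filter.Tendsto (fun t : ℂ => (coeffMatrix M fun i => g i + C t * g' i)ᵀ) (𝓝 0)
      (𝓝 (coeffMatrix M g)ᵀ) :=
    (continuous_id.matrix_transpose.tendsto _).comp (tendsto_coeffMatrix g g')
  have hKinj : ∀ x, (coeffMatrix M g)ᵀ *ᵥ x = 0 → x = 0 := by
    intro x hx
    have hsum : ∑ i, C (x i) * g i = q₁ * vecPoly (fun i => x (Sum.inl i))
        + q₂ * vecPoly (fun i => x (Sum.inr i)) := by
      simp only [Fintype.sum_sum_type, g, Sum.elim_inl, Sum.elim_inr, vecPoly, Finset.mul_sum]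
      congr 1 <;> exact Finset.sum_congr rfl fun i _ => by ring
    have hmem : ∑ i, C (x i) * g i ∈ degreeLT ℂ M := Submodule.sum_mem _ fun i _ => by
      rw [← smul_eq_C_mul]
      exact Submodule.smul_mem _ _ (hgM i)
    have hzero : ∑ i, C (x i) * g i = 0 := by
      have hcoeff : (fun s : Fin M => (∑ i, C (x i) * g i).coeff s) = 0 := funext fun s => by
        rw [← coeffMatrix_transpose_mulVec, hx]
      rw [← vecPoly_coeff hmem, hcoeff]
      simp [vecPoly]
    rw [hsum] at hzero
    have hu : vecPoly (fun i => x (Sum.inl i)) ∈ degreeLT ℂ b :=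
      degreeLT_mono (by omega) (vecPoly_mem _)
    have hv : vecPoly (fun i => x (Sum.inr i)) ∈ degreeLT ℂ a :=
      degreeLT_mono (by omega) (vecPoly_mem _)
    obtain ⟨h1, h2⟩ := H.eq_zero_of_mul_eq_mul hu (Submodule.neg_mem _ hv)
      (by rw [mul_neg]; exact eq_neg_of_add_eq_zero_left hzero)
    rw [neg_eq_zero] at h2
    ext (i | i)
    · exact congrFun (vecPoly_eq_zero h1) i
    · exact congrFun (vecPoly_eq_zero h2) i
  have hHlim : Filter.Tendsto (fun t => symbolHankel (M := M) (N := N) (A' t)) (𝓝 0)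
      (𝓝 (symbolHankel A)) := by
    have hc : Continuous fun A : Fin (M + N - 1) → ℂ => symbolHankel (M := M) (N := N) A :=
      continuous_matrix fun i j => by
        simp only [symbolHankel, Matrix.of_apply]
        fun_prop
    exact (hc.tendsto A).comp hlim
  -- Near `0` the range of the deformed symbol matrix is exactly the kernel of `L`: it is contained
  -- there, and both have dimension `N = M - (e + f)`. The old observation lies in that kernel
  -- because `r` kills the shifted channels.
  have hsolve : ∀ᶠ t in 𝓝 (0 : ℂ), ∀ c : Fin m, ∃ x, symbolHankel (M := M) (A' t) *ᵥ x
      = symbolHankel (M := M) A *ᵥ fun i => h (i, c) := by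
    filter_upwards [hA', Matrix.eventually_mulVec_eq_zero_imp hKlim hKinj,
      Matrix.eventually_mulVec_eq_zero_imp hHlim hinj] with t ht hK hH c
    set L := coeffMatrix M fun i => g i + C t * g' i with hL
    have hle : LinearMap.range (symbolHankel (M := M) (N := N) (A' t)).mulVecLin
        ≤ LinearMap.ker L.mulVecLin := by
      rintro _ ⟨x, rfl⟩
      rw [LinearMap.mem_ker, Matrix.mulVecLin_apply, Matrix.mulVecLin_apply]
      funext i
      rw [hL, coeffMatrix_mulVec_symbolHankel (hgt t)]
      have hxN : vecPoly x ∈ degreeLT ℂ N := vecPoly_mem x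
      rcases i with i | i
      · simp only [g, g', Sum.elim_inl, mul_zero, add_zero, mul_assoc]
        exact ht.1 _ (mul_mem_degreeLT (X_pow_mem_degreeLT (Nat.lt_succ_self _)) hxN (by omega))
      · simp only [g, g', Sum.elim_inr, ← mul_assoc, ← add_mul]
        rw [mul_assoc]
        exact ht.2 _ (mul_mem_degreeLT (X_pow_mem_degreeLT (Nat.lt_succ_self _)) hxN (by omega))
    have hrank : Module.finrank ℂ (LinearMap.range L.mulVecLin) = f + e := by
      change L.rank = _
      rw [← Matrix.rank_transpose]
      change Module.finrank ℂ (LinearMap.range Lᵀ.mulVecLin) = _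
      rw [LinearMap.finrank_range_of_inj (LinearMap.ker_eq_bot.1 (LinearMap.ker_eq_bot'.2 hK))]
      simp
    have hker := LinearMap.finrank_range_add_finrank_ker L.mulVecLin
    have hrange : LinearMap.range (symbolHankel (M := M) (N := N) (A' t)).mulVecLin
        = LinearMap.ker L.mulVecLin := by
      refine Submodule.eq_of_le_of_finrank_eq hle ?_
      rw [LinearMap.finrank_range_of_inj (LinearMap.ker_eq_bot.1 (LinearMap.ker_eq_bot'.2 hH)),
        Module.finrank_fin_fun]
      rw [hrank, Module.finrank_fin_fun] at hker
      omega
    change (symbolHankel (M := M) A *ᵥ fun i => h (i, c))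
      ∈ LinearMap.range (symbolHankel (M := M) (N := N) (A' t)).mulVecLin
    rw [hrange, LinearMap.mem_ker, Matrix.mulVecLin_apply]
    funext i
    rw [hL, coeffMatrix_mulVec_symbolHankel (hgt t)]
    have hxN := vecPoly_mem fun i => h (i, c)
    rcases i with i | i
    · simp only [g, g', Sum.elim_inl, mul_zero, add_zero, mul_assoc]
      exact H.left_annihilates _
        (mul_mem_degreeLT (X_pow_mem_degreeLT (Nat.lt_succ_self _)) hxN (by omega))
    · simp only [g, g', Sum.elim_inr]
      rw [add_mul, map_add, mul_assoc, mul_assoc, ← smul_eq_C_mul, map_smul, mul_assoc,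
        hrh c i (by omega), smul_zero, add_zero]
      exact H.right_annihilates _
        (mul_mem_degreeLT (X_pow_mem_degreeLT (Nat.lt_succ_self _)) hxN (by omega))
  have hsolve' : ∀ᶠ t in 𝓝 (0 : ℂ), ∃ x : Fin m → Fin N → ℂ, ∀ c,
      symbolHankel (M := M) (A' t) *ᵥ x c = symbolHankel (M := M) A *ᵥ fun i => h (i, c) :=
    hsolve.mono fun t ht => Classical.axiom_of_choice ht
  obtain ⟨x, hx⟩ := hsolve'.choice
  refine ⟨fun t p => x t p.2 p.1, ?_, ?_⟩
  · refine tendsto_pi_nhds.2 fun p => ?_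
    exact tendsto_pi_nhds.1 (Matrix.tendsto_of_tendsto_mulVec hHlim hinj
      (x := fun t => x t p.2) (x₀ := fun i => h (i, p.2)) (hx.mono fun t ht => ht p.2)) p.1
  · filter_upwards [hx] with t ht
    funext p
    rw [channelMatrix_mulVec_eq_symbolHankel, channelMatrix_mulVec_eq_symbolHankel]
    exact congrFun (ht p.2) p.1

end Deformation

/-! ### Local identifiability forces a one-dimensional kernel -/

section Converse

open Polynomial

theorem mul_vecPoly_of_jacobianMatrix_mulVec_eq_zero {M N m : ℕ} {A : Fin (M + N - 1) → ℂ}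
    {h : Fin N × Fin m → ℂ} {d : ParamIdx M N m → ℂ} (hd : jacobianMatrix A h *ᵥ d = 0)
    (c : Fin m) {k : ℂ[X]} (hk : k ∈ degreeLT ℂ M) :
    symbolFunctional (symbolPart d) (k * vecPoly fun i => h (i, c))
      = -symbolFunctional A (k * vecPoly fun i => channelPart d (i, c)) := by
  rw [← add_eq_zero_iff_eq_neg]
  refine map_eq_zero_of_forall_X_pow
    (symbolFunctional (symbolPart d) ∘ₗ LinearMap.mulRight ℂ (vecPoly fun i => h (i, c))
      + symbolFunctional A ∘ₗ LinearMap.mulRight ℂ (vecPoly fun i => channelPart d (i, c)))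
    (fun r hr => ?_) hk
  have := congrFun hd (⟨r, hr⟩, c)
  rw [jacobianMatrix_mulVec, Pi.add_apply, channelMatrix_mulVec_eq_symbolHankel,
    channelMatrix_mulVec_eq_symbolHankel, symbolHankel_mulVec_apply,
    symbolHankel_mulVec_apply] at this
  exact this

/-- For `a > 0`, multiplication by powers of `X` extends the span. For `a = 0` the hypothesis is
empty, but then `N = 1` and some `h_c` is a nonzero constant. -/
theorem span_shifted_channels_mono {N m a b : ℕ} (hN : 1 ≤ N) (hab : a ≤ b)
    {h : Fin N × Fin m → ℂ} (hh : h ≠ 0) (hNa : N ≤ a + 1)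
    (hspan : degreeLT ℂ a ≤ Submodule.span ℂ
      {p : ℂ[X] | ∃ c j, j + N < a + 1 ∧ p = X ^ j * vecPoly fun i => h (i, c)}) :
    degreeLT ℂ b ≤ Submodule.span ℂ
      {p : ℂ[X] | ∃ c j, j + N < b + 1 ∧ p = X ^ j * vecPoly fun i => h (i, c)} := by
  classical
  conv_lhs => rw [degreeLT_eq_span_X_pow]
  rw [Submodule.span_le]
  intro p hp
  simp only [Finset.coe_image, Set.mem_image, Finset.coe_range, Set.mem_Iio] at hp
  obtain ⟨i, hi, rfl⟩ := hp
  rcases Nat.eq_zero_or_pos a with ha | ha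
  · obtain rfl : N = 1 := by omega
    obtain ⟨⟨z, c⟩, hzc⟩ := Function.ne_iff.1 hh
    obtain rfl : z = 0 := Subsingleton.elim _ _
    have hpoly : (X ^ i : ℂ[X]) = (h (0, c))⁻¹ • (X ^ i * vecPoly fun j => h (j, c)) := by
      rw [vecPoly, Fin.sum_univ_one, Fin.val_zero, pow_zero, mul_one, mul_comm, ← smul_eq_C_mul,
        smul_smul, inv_mul_cancel₀ hzc, one_smul]
    rw [hpoly]
    exact Submodule.smul_mem _ _ (Submodule.subset_span ⟨c, i, by omega, rfl⟩)
  · obtain ⟨i', k, hi', hk, rfl⟩ : ∃ i' k, i' < a ∧ k + a ≤ b ∧ i = k + i' :=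
      ⟨min i (a - 1), i - min i (a - 1), by omega, by omega, by omega⟩
    have hle : Submodule.span ℂ
        {p : ℂ[X] | ∃ c j, j + N < a + 1 ∧ p = X ^ j * vecPoly fun i => h (i, c)}
        ≤ (Submodule.span ℂ
          {p : ℂ[X] | ∃ c j, j + N < b + 1 ∧ p = X ^ j * vecPoly fun i => h (i, c)}).comap
          (LinearMap.mulLeft ℂ (X ^ k)) := by
      rw [Submodule.span_le]
      rintro _ ⟨c, j, hj, rfl⟩
      refine Submodule.subset_span ⟨c, k + j, by omega, ?_⟩
      rw [LinearMap.mulLeft_apply, ← mul_assoc, pow_add]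
    have := hle (hspan (X_pow_mem_degreeLT hi'))
    rwa [Submodule.mem_comap, LinearMap.mulLeft_apply, ← pow_add] at this

theorem IsApolarPair.ker_le_span {M N m a b : ℕ} {A : Fin (M + N - 1) → ℂ} {q₁ q₂ : ℂ[X]}
    (hN : 1 ≤ N) (hA : A ≠ 0)
    (hinj : ∀ x, symbolHankel (M := M) (N := N) A *ᵥ x = 0 → x = 0)
    (hP : a + b + 1 = M + N - 1) (H : IsApolarPair (symbolFunctional A) a b q₁ q₂)
    {h : Fin N × Fin m → ℂ} (hh : h ≠ 0)
    (hspan : degreeLT ℂ a ≤ Submodule.span ℂ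
      {p : ℂ[X] | ∃ c j, j + N < a + 1 ∧ p = X ^ j * vecPoly fun i => h (i, c)})
    {d : ParamIdx M N m → ℂ} (hd : jacobianMatrix A h *ᵥ d = 0) :
    ∃ c : ℂ, d = c • (Sum.elim (-A) h : ParamIdx M N m → ℂ) := by
  have hab := H.le
  have hNa := le_of_symbolHankel_injective hinj hP H
  have hspan' := span_shifted_channels_mono hN hab hh hNa hspan
  have hX : ∀ {j n : ℕ} (x : Fin N → ℂ), j + N < n + 1 → X ^ j * vecPoly x ∈ degreeLT ℂ n :=
    fun x hj => mul_mem_degreeLT (X_pow_mem_degreeLT (Nat.lt_succ_self _)) (vecPoly_mem x)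
      (by omega)
  -- Testing the kernel equation against `q X^j` moves the perturbation onto the channel, where `q`
  -- annihilates `A`. Both generators are covered, with `a` and `b` exchanged.
  have key : ∀ (q : ℂ[X]) (n n' : ℕ), q ∈ degreeLT ℂ (n' + 2) → n' + n + 2 ≤ M + N →
      (∀ p ∈ degreeLT ℂ n, symbolFunctional A (q * p) = 0) →
      degreeLT ℂ n ≤ Submodule.span ℂ
        {p : ℂ[X] | ∃ c j, j + N < n + 1 ∧ p = X ^ j * vecPoly fun i => h (i, c)} →
      ∀ p ∈ degreeLT ℂ n, symbolFunctional (symbolPart d) (q * p) = 0 := by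
    intro q n n' hq hn hkill hle p hp
    have hle' : Submodule.span ℂ
        {p : ℂ[X] | ∃ c j, j + N < n + 1 ∧ p = X ^ j * vecPoly fun i => h (i, c)}
        ≤ LinearMap.ker (symbolFunctional (symbolPart d) ∘ₗ LinearMap.mulLeft ℂ q) := by
      rw [Submodule.span_le]
      rintro _ ⟨c, j, hj, rfl⟩
      change symbolFunctional (symbolPart d) (q * (X ^ j * vecPoly fun i => h (i, c))) = 0
      rw [← mul_assoc, mul_vecPoly_of_jacobianMatrix_mulVec_eq_zero hd c
        (mul_mem_degreeLT hq (X_pow_mem_degreeLT (Nat.lt_succ_self j)) (by omega)), mul_assoc,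
        hkill _ (hX _ hj), neg_zero]
    exact hle' (hle hp)
  obtain ⟨c, hc⟩ := H.exists_eq_mul (by rw [hP]; exact exists_symbolFunctional_ne_zero hA)
    (symbolFunctional (symbolPart d))
    (key q₁ b a H.left_mem (by omega) H.left_annihilates hspan')
    (key q₂ a b H.right_mem (by omega) H.right_annihilates hspan)
  have hdA : symbolPart d = c • A := by
    funext s
    rw [← symbolFunctional_X_pow (symbolPart d), Pi.smul_apply, smul_eq_mul,
      ← symbolFunctional_X_pow A]
    exact hc _ (X_pow_mem_degreeLT (by omega))
  have hdh : channelPart d = (-c) • h := by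
    have hzero : ∀ k : Fin m, (fun i => (channelPart d + c • h) (i, k)) = 0 := fun k => by
      refine hinj _ (funext fun r => ?_)
      have := congrFun hd (r, k)
      rw [jacobianMatrix_mulVec, hdA, Matrix.mulVec_smul, Pi.add_apply, Pi.smul_apply,
        channelMatrix_mulVec_eq_symbolHankel, channelMatrix_mulVec_eq_symbolHankel,
        ← Pi.smul_apply, ← Matrix.mulVec_smul, ← Pi.add_apply, ← Matrix.mulVec_add] at this
      rw [show (fun i => (channelPart d + c • h) (i, k))
        = (c • (fun i => h (i, k)) + fun i => channelPart d (i, k)) from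
        funext fun i => add_comm _ _]
      exact this
    ext ⟨i, k⟩
    have := congrFun (hzero k) i
    simp only [Pi.add_apply, Pi.smul_apply, smul_eq_mul, Pi.zero_apply] at this ⊢
    linear_combination this
  refine ⟨-c, ?_⟩
  ext (s | s)
  · have := congrFun hdA s
    simp only [symbolPart, Pi.smul_apply, smul_eq_mul] at this
    simp [this]
  · have := congrFun hdh s
    simp only [channelPart, Pi.smul_apply, smul_eq_mul] at this
    simp [this]

/-- A local curve of parameters with constant noiseless observation contains scale equivalent
points away from its origin. -/
theorem LocallyBlindlyIdentifiable.exists_scaleEquivalent {M N m : ℕ} {σ : ℝ} (hσ : 0 < σ)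
    {A : Fin (M + N - 1) → ℂ} {h : Fin N × Fin m → ℂ}
    (hid : LocallyBlindlyIdentifiable (M := M) σ (Sum.elim A h))
    {A' : ℂ → Fin (M + N - 1) → ℂ} {h' : ℂ → Fin N × Fin m → ℂ}
    (hA' : Filter.Tendsto A' (𝓝 0) (𝓝 A)) (hh' : Filter.Tendsto h' (𝓝 0) (𝓝 h))
    (hmean : ∀ᶠ t in 𝓝 (0 : ℂ), channelMatrix M (h' t) *ᵥ A' t = channelMatrix M h *ᵥ A)
    {p : ℂ → Prop} (hp : ∀ᶠ t in 𝓝 (0 : ℂ), p t) :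
    ∃ t, t ≠ 0 ∧ p t ∧ ∃ α : ℂ, α ≠ 0 ∧ A' t = α • A ∧ h' t = α⁻¹ • h := by
  obtain ⟨U, hU, hUeq⟩ := hid
  have hlim : Filter.Tendsto (fun t => (Sum.elim (A' t) (h' t) : ParamIdx M N m → ℂ)) (𝓝 0)
      (𝓝 (Sum.elim A h)) := by
    refine tendsto_pi_nhds.2 fun k => ?_
    rcases k with s | s
    · exact tendsto_pi_nhds.1 hA' s
    · exact tendsto_pi_nhds.1 hh' s
  have hev := ((hlim.eventually hU).and (hmean.and hp)).filter_mono
    (nhdsWithin_le_nhds (s := {0}ᶜ))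
  obtain ⟨t, ⟨htU, htm, htp⟩, ht0⟩ := (hev.and self_mem_nhdsWithin).exists
  exact ⟨t, ht0, htp, hUeq _ htU ((likelihood_eq_iff hσ _ _).2 htm.symm)⟩

theorem tendsto_add_smul {ι : Type*} (x d : ι → ℂ) :
    Filter.Tendsto (fun t : ℂ => x + t • d) (𝓝 0) (𝓝 x) := by
  have : Continuous fun t : ℂ => x + t • d := by fun_prop
  simpa using this.tendsto 0

theorem exists_eq_smul_of_locallyBlindlyIdentifiable {M N m : ℕ} (hN : 1 ≤ N) (hm : 1 ≤ m)
    {σ : ℝ} (hσ : 0 < σ) {A : Fin (M + N - 1) → ℂ} {h : Fin N × Fin m → ℂ}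
    (hid : LocallyBlindlyIdentifiable (M := M) σ (Sum.elim A h))
    {d : ParamIdx M N m → ℂ} (hd : jacobianMatrix A h *ᵥ d = 0) :
    ∃ c : ℂ, d = c • (Sum.elim (-A) h : ParamIdx M N m → ℂ) := by
  have htrue : ∀ᶠ t in 𝓝 (0 : ℂ), True := Filter.Eventually.of_forall fun _ => trivial
  have hd' := hd
  rw [jacobianMatrix_mulVec] at hd'
  -- With `A = 0`, moving the symbols alone along `d` keeps the mean zero, and scale equivalence to
  -- `0` forces that part of `d` to vanish. Moving the channel alone then shows its part is a
  -- multiple of `h`.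
  by_cases hA : A = 0
  · subst hA
    rw [Matrix.mulVec_zero, add_zero] at hd'
    obtain ⟨t, ht, -, α, hα, h1, -⟩ := hid.exists_scaleEquivalent hσ
      (tendsto_add_smul 0 (symbolPart d)) (tendsto_const_nhds (x := h))
      (Filter.Eventually.of_forall fun t => by
        rw [zero_add, Matrix.mulVec_smul, hd', smul_zero, Matrix.mulVec_zero]) htrue
    have hdA : symbolPart d = 0 := by
      rw [zero_add, smul_zero] at h1
      exact (smul_eq_zero.1 h1).resolve_left ht
    obtain ⟨t, ht, -, α, hα, -, h2⟩ := hid.exists_scaleEquivalent hσ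
      (tendsto_const_nhds (x := 0)) (tendsto_add_smul h (channelPart d))
      (Filter.Eventually.of_forall fun t => by rw [Matrix.mulVec_zero, Matrix.mulVec_zero]) htrue
    refine ⟨t⁻¹ * (α⁻¹ - 1), ?_⟩
    ext (s | s)
    · have := congrFun hdA s
      simpa [symbolPart] using this
    · have := congrFun h2 s
      simp only [channelPart, Pi.add_apply, Pi.smul_apply, smul_eq_mul, Sum.elim_inr] at this ⊢
      rw [mul_assoc, eq_inv_mul_iff_mul_eq₀ ht]
      linear_combination this
  have hα1 : ∀ α : ℂ, A = α • A → α = 1 := fun α hα => by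
    have : (α - 1) • A = 0 := by rw [sub_smul, one_smul, ← hα, sub_self]
    exact sub_eq_zero.1 ((smul_eq_zero.1 this).resolve_right hA)
  have hinj : ∀ x, symbolHankel (M := M) (N := N) A *ᵥ x = 0 → x = 0 := by
    intro x hx
    -- Adding a kernel vector to every subchannel leaves the mean and `A` unchanged, so the scale
    -- factor is `1` and the vector is zero.
    obtain ⟨t, ht, -, α, hα, h1, h2⟩ := hid.exists_scaleEquivalent hσ
      (tendsto_const_nhds (x := A)) (tendsto_add_smul h fun p => x p.1)
      (Filter.Eventually.of_forall fun t => by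
        funext p
        rw [channelMatrix_mulVec_eq_symbolHankel, channelMatrix_mulVec_eq_symbolHankel]
        change (symbolHankel (M := M) A *ᵥ ((fun i => h (i, p.2)) + t • x)) p.1 = _
        rw [Matrix.mulVec_add, Matrix.mulVec_smul, hx, smul_zero, add_zero]) htrue
    rw [hα1 α h1, inv_one, one_smul] at h2
    ext i
    have := congrFun h2 (i, ⟨0, hm⟩)
    simpa [ht] using this
  by_cases hh : h = 0
  · subst hh
    have hconv : ∀ B, channelMatrix M (0 : Fin N × Fin m → ℂ) *ᵥ B = 0 := fun B => by
      funext p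
      rw [channelMatrix_mulVec_apply]
      simp
    rw [hconv, zero_add] at hd'
    have hdh : channelPart d = 0 := by
      ext ⟨i, k⟩
      refine congrFun (hinj (fun i => channelPart d (i, k)) (funext fun r => ?_)) i
      have := congrFun hd' (r, k)
      rwa [channelMatrix_mulVec_eq_symbolHankel] at this
    obtain ⟨t, ht, -, α, hα, h1, -⟩ := hid.exists_scaleEquivalent hσ
      (tendsto_add_smul A (symbolPart d)) (tendsto_const_nhds (x := 0))
      (Filter.Eventually.of_forall fun t => by rw [hconv, hconv]) htrue
    refine ⟨-(t⁻¹ * (α - 1)), ?_⟩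
    ext (s | s)
    · have := congrFun h1 s
      simp only [symbolPart, Pi.add_apply, Pi.smul_apply, Pi.neg_apply, smul_eq_mul,
        Sum.elim_inl] at this ⊢
      rw [neg_mul_neg, mul_assoc, eq_inv_mul_iff_mul_eq₀ ht]
      linear_combination this
    · have := congrFun hdh s
      simpa [channelPart] using this
  obtain ⟨a, b, q₁, q₂, hP, H⟩ := exists_isApolarPair (symbolFunctional A)
    (exists_symbolFunctional_ne_zero hA)
  refine H.ker_le_span hN hA hinj hP hh ?_ hd
  by_contra hspan
  obtain ⟨r, hr, hrS, p, hp, hrp⟩ := H.exists_annihilating_of_lt hspan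
  obtain ⟨A', hA', hkill⟩ := H.exists_symbols hA hP r
  obtain ⟨h', hh', hmean⟩ := H.exists_channels hN hinj hP hr h (fun c j hj =>
    hrS _ (Submodule.subset_span ⟨c, j, hj, rfl⟩)
      (mul_mem_degreeLT (X_pow_mem_degreeLT (Nat.lt_succ_self _)) (vecPoly_mem _) (by omega)))
    hA' hkill
  obtain ⟨t, ht, hkt, α, hα, h1, -⟩ := hid.exists_scaleEquivalent hσ hA' hh' hmean hkill
  have hsmul : ∀ q, symbolFunctional (α • A) q = α * symbolFunctional A q := fun q => by
    simp only [symbolFunctional_apply, Pi.smul_apply, smul_eq_mul, Finset.mul_sum]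
    exact Finset.sum_congr rfl fun s _ => by ring
  -- If the deformed symbols were `α A`, the deformed equation would reduce to `α t φ(r p) = 0`,
  -- with all three factors nonzero.
  have := hkt.2 p hp
  rw [h1, hsmul, add_mul, map_add, H.right_annihilates p hp, zero_add, mul_assoc,
    ← smul_eq_C_mul, map_smul, smul_eq_mul] at this
  exact mul_ne_zero hα (mul_ne_zero ht hrp) this

theorem finrank_ker_eq_one_of_locallyBlindlyIdentifiable {M N m : ℕ} (hM : 1 ≤ M) (hN : 1 ≤ N)
    (hm : 1 ≤ m) {σ : ℝ} (hσ : 0 < σ) {A : Fin (M + N - 1) → ℂ} {h : Fin N × Fin m → ℂ}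
    (hid : LocallyBlindlyIdentifiable (M := M) σ (Sum.elim A h)) :
    Module.finrank ℂ (LinearMap.ker (jacobianMatrix A h).mulVecLin) = 1 := by
  have hker : LinearMap.ker (jacobianMatrix A h).mulVecLin
      = Submodule.span ℂ {(Sum.elim (-A) h : ParamIdx M N m → ℂ)} := by
    refine le_antisymm (fun d hd => ?_) ?_
    · obtain ⟨c, hc⟩ := exists_eq_smul_of_locallyBlindlyIdentifiable hN hm hσ hid hd
      exact Submodule.mem_span_singleton.2 ⟨c, hc.symm⟩
    · rw [Submodule.span_singleton_le_iff_mem]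
      exact jacobianMatrix_mulVec_scale A h
  rw [hker]
  refine finrank_span_singleton fun h0 => ?_
  have hA : A = 0 := by
    ext s; simpa using congrFun h0 (Sum.inl s)
  have hh : h = 0 := by
    ext s; simpa using congrFun h0 (Sum.inr s)
  subst hA hh
  -- At the origin every direction is in the kernel, yet each would be a multiple of the zero
  -- vector.
  obtain ⟨c, hc⟩ := exists_eq_smul_of_locallyBlindlyIdentifiable hN hm hσ hid
    (d := fun _ => 1) (by rw [jacobianMatrix_zero, Matrix.zero_mulVec])
  have := congrFun hc (Sum.inl ⟨0, by omega⟩)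
  simp at this

end Converse

/-! ### Kernel of the FIM and conclusion -/

open scoped ComplexOrder in
theorem ker_complexFIM_eq {M N m : ℕ} {σ : ℝ} (hσ : 0 < σ) (A : Fin (M + N - 1) → ℂ)
    (h : Fin N × Fin m → ℂ) :
    LinearMap.ker (complexFIM (M := M) σ (Sum.elim A h)).mulVecLin
      = LinearMap.ker (jacobianMatrix A h).mulVecLin := by
  have hσ' : ((σ : ℂ) ^ 2)⁻¹ ≠ 0 := inv_ne_zero (by exact_mod_cast (pow_pos hσ 2).ne')
  rw [← Matrix.ker_mulVecLin_conjTranspose_mul_self (jacobianMatrix A h), complexFIM_eq hσ]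
  ext x
  rw [LinearMap.mem_ker, LinearMap.mem_ker, Matrix.mulVecLin_apply, Matrix.mulVecLin_apply,
    Matrix.smul_mulVec, smul_eq_zero]
  exact or_iff_right hσ'

theorem mainTheorem4 (M N m : ℕ) (hM : 1 ≤ M) (hN : 1 ≤ N) (hm : 1 ≤ m)
    (σ : ℝ) (hσ : 0 < σ)
    (A : Fin (M + N - 1) → ℂ) (h : Fin N × Fin m → ℂ) :
    complexFIM (M := M) σ (Sum.elim A h)
        = ((σ : ℂ) ^ 2)⁻¹ • ((jacobianMatrix A h)ᴴ * jacobianMatrix A h) ∧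
    (LocallyBlindlyIdentifiable (M := M) σ (Sum.elim A h) ↔
      Module.finrank ℂ (LinearMap.ker (complexFIM (M := M) σ (Sum.elim A h)).mulVecLin) = 1) ∧
    (Module.finrank ℂ (LinearMap.ker (complexFIM (M := M) σ (Sum.elim A h)).mulVecLin) = 1 →
      LinearMap.ker (complexFIM (M := M) σ (Sum.elim A h)).mulVecLin
        = Submodule.span ℂ {(Sum.elim (-A) h : ParamIdx M N m → ℂ)}) := by
  rw [ker_complexFIM_eq hσ]
  exact ⟨complexFIM_eq hσ A h,
    ⟨finrank_ker_eq_one_of_locallyBlindlyIdentifiable hM hN hm hσ,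
      locallyBlindlyIdentifiable_of_finrank_ker_eq_one hM hN hm hσ A h⟩,
    ker_jacobianMatrix_eq_span hM hN hm⟩
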